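/- **Setting.** Let $Q$ be a finite-dimensional smooth manifold and $G$ a Lie group with Lie algebra $\mathfrak g$, acting smoothly on the left on $Q$ so that $\pi:Q\to Q/G$ is a smooth principal $G$-bundle. For $\xi\in\mathfrak g$ let $\xi_Q(q)=\frac{d}{dt}\big|_{t=0}\exp(t\xi)\cdot q$, and let $\mathcal V_q=\ker T_q\pi$. For a function $f$ on a product manifold, $D_if$ denotes the restriction of its differential to the tangent space of the $i$-th factor. *The system.* A nonholonomic discrete mechanical system $(Q,L_d,\mathcal D,\mathcal D_d)$ consists of a smooth function $L_d:Q\times Q\to\mathbb R$, a smooth subbundle $\mathcal D\subseteq TQ$ and an embedded submanifold $\mathcal D_d\subseteq Q\times Q$. Assume that $G$ is a symmetry group: $L_d$ and $\mathcal D_d$ are invariant under the diagonal action of $G$ on $Q\times Q$, and $\mathcal D$ is invariant under the lifted action on $TQ$. Assume that $\mathcal S:=\mathcal V\cap\mathcal D$ is a subbundle and that there is a decomposition $TQ=\mathcal W\oplus\mathcal U\oplus\mathcal S\oplus\mathcal H$ into $G$-invariant smooth subbundles with $\mathcal D=\mathcal S\oplus\mathcal H$ and $\mathcal V=\mathcal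 S\oplus\mathcal U$. Let $h^q:T_{\pi(q)}(Q/G)\to T_qQ$ be the horizontal lift of the connection with horizontal space $\mathcal W\oplus\mathcal H$, that is, the inverse of $T_q\pi|_{\mathcal W_q\oplus\mathcal H_q}$. Put $\hat{\mathcal D}_{\pi(q)}:=T_q\pi(\mathcal D_q)$ and $\mathfrak g^{\mathcal D}_q:=\{\xi\in\mathfrak g:\xi_Q(q)\in\mathcal D_q\}$. *The discrete connection.* Let $\mathrm{Hor}\subseteq Q\times Q$ be an affine discrete connection defined on the whole of $Q\times Q$: an embedded submanifold, invariant under the diagonal action, containing the graph of $q\mapsto\gamma(q)\cdot q$ for a smooth $\gamma:Q\to G$ with $\gamma(g\cdot q)=g\gamma(q)g^{-1}$, such that $(\mathrm{id}_Q\times\pi)|_{\mathrm{Hor}}:\mathrm{Hor}\to Q\times Q/G$ is an injective local diffeomorphism, and such that for all $(q_0,q_1)\in Q\times Q$ there is $g\in G$ with $(q_0,g^{-1}\cdot q_1)\in\mathrm{Hor}$. This $g$ is unique and is denoted $\mathcal A_d(q_0,q_1)$. For $q\in Q$ and $\tau\in Q/G$ let $\overline{h_d^{q}}(\tau)$ be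 the unique $q_1$ with $(q,q_1)\in\mathrm{Hor}$ and $\pi(q_1)=\tau$. *The reduced objects.* Let $\tilde G:=(Q\times G)/G$ for the action $g\cdot(q,w)=(g\cdot q,gwg^{-1})$, with its quotient smooth structure and quotient map $\rho$. Let $\Phi:(Q\times Q)/G\to\tilde G\times Q/G$ be the map induced by $(q_0,q_1)\mapsto(\rho(q_0,\mathcal A_d(q_0,q_1)),\pi(q_1))$ and put $\hat{\mathcal D}_d:=\Phi(\mathcal D_d/G)$. Define $\check L_d:Q\times G\times Q/G\to\mathbb R$ by $\check L_d(q,w,\tau):=L_d(q,\,w\cdot\overline{h_d^{q}}(\tau))$ and $\hat L_d:\tilde G\times Q/G\to\mathbb R$ by $\hat L_d(\rho(q,w),\tau):=\check L_d(q,w,\tau)$. The discrete actions are $S_d(q_\cdot):=\sum_{k=0}^{N-1}L_d(q_k,q_{k+1})$ on $Q^{N+1}$ and $\hat S_d(v_\cdot,\tau_\cdot):=\sum_{k=0}^{N-1}\hat L_d(v_k,\tau_{k+1})$ on $(\tilde G\times Q/G)^N$. **Theorem (nonholonomic discrete reduction).** Let $q_\cdot=(q_0,\dots,q_N)$ be a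 discrete curve on $Q$ and put $\tau_k:=\pi(q_k)$, $w_k:=\mathcal A_d(q_k,q_{k+1})$, $v_k:=\rho(q_k,w_k)$. The following statements are equivalent. 1. $(q_k,q_{k+1})\in\mathcal D_d$ for $0\le k\le N-1$, and $dS_d(q_\cdot)(\delta q_\cdot)=0$ for all $\delta q_\cdot$ with $\delta q_k\in\mathcal D_{q_k}$ for $0\le k\le N$ and $\delta q_0=0$, $\delta q_N=0$. 2. $(q_k,q_{k+1})\in\mathcal D_d$ for $0\le k\le N-1$, and $D_1L_d(q_k,q_{k+1})+D_2L_d(q_{k-1},q_k)$ vanishes on $\mathcal D_{q_k}$ for $1\le k\le N-1$. 3. $(v_k,\tau_{k+1})\in\hat{\mathcal D}_d$ for $0\le k\le N-1$, and $d\hat S_d(v_\cdot,\tau_\cdot)(\delta v_\cdot,\delta\tau_\cdot)=0$ whenever there are $\delta\tau_k\in\hat{\mathcal D}_{\tau_k}$ and $\xi_k\in\mathfrak g^{\mathcal D}_{q_k}$ ($0\le k\le N$) with $\delta\tau_0=0$, $\delta\tau_N=0$, $\xi_0=\xi_N=0$ and, for $0\le k\le N-1$, $$\begin{aligned}\delta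 v_k={}&T_{(q_k,w_k)}\rho\big(h^{q_k}(\delta\tau_k),\,T_{(q_k,q_{k+1})}\mathcal A_d(h^{q_k}(\delta\tau_k),h^{q_{k+1}}(\delta\tau_{k+1}))\big)\\&+T_{(q_k,w_k)}\rho\big((\xi_k)_Q(q_k),\,T_{(q_k,q_{k+1})}\mathcal A_d((\xi_k)_Q(q_k),(\xi_{k+1})_Q(q_{k+1}))\big).\end{aligned}$$ 4. $(v_k,\tau_{k+1})\in\hat{\mathcal D}_d$ for $0\le k\le N-1$, and for $1\le k\le N-1$ the following two conditions hold. - The covector $\phi\in T^*_{\tau_k}(Q/G)$, $$\phi:=D_1\check L_d(q_k,w_k,\tau_{k+1})\circ h^{q_k}+D_3\check L_d(q_{k-1},w_{k-1},\tau_k)+\hat f_d^-(v_k,\tau_{k+1})+\hat f_d^+(v_{k-1},\tau_k),$$ vanishes on $\hat{\mathcal D}_{\tau_k}$, where $\hat f_d^-(v_k,\tau_{k+1})(\delta\tau):=D_2\check L_d(q_k,w_k,\tau_{k+1})\,T_{(q_k,q_{k+1})}\mathcal A_d(h^{q_k}(\delta\tau),0)$ and $\hat f_d^+(v_{k-1},\tau_k)(\delta\tau):=D_2\check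 L_d(q_{k-1},w_{k-1},\tau_k)\,T_{(q_{k-1},q_k)}\mathcal A_d(0,h^{q_k}(\delta\tau))$. - The covector $\psi\in\mathfrak g^*$, $$\psi:=D_2\check L_d(q_{k-1},w_{k-1},\tau_k)\,w_{k-1}^{-1}-D_2\check L_d(q_k,w_k,\tau_{k+1})\,w_k^{-1},$$ vanishes on $\mathfrak g^{\mathcal D}_{q_k}$, where for $w\in G$ and $\alpha\in T_w^*G$ the covector $\alpha w^{-1}\in\mathfrak g^*$ is $\xi\mapsto\alpha(T_eR_w\xi)$, $R_w$ being right translation by $w$. -/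

import Mathlib

open scoped Manifold ContDiff Topology
open Set

set_option linter.unusedSectionVars false

noncomputable section

namespace DiscreteReduction

/-! ### Principal bundles and the conjugate bundle -/

section PrincipalBundle

variable (E EG EB G Q : Type*)
  [NormedAddCommGroup E] [NormedSpace ℝ E] [NormedAddCommGroup EG] [NormedSpace ℝ EG]
  [NormedAddCommGroup EB] [NormedSpace ℝ EB]
  [TopologicalSpace G] [ChartedSpace EG G] [Group G]
  [TopologicalSpace Q] [ChartedSpace E Q] [MulAction G Q]

/-- The orbit space `Q/G`, with the quotient topology. -/
abbrev Shape : Type _ := MulAction.orbitRel.Quotient G Q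

/-- The quotient map `π : Q → Q/G`. -/
def proj (q : Q) : Shape G Q := Quotient.mk (MulAction.orbitRel G Q) q

variable [ChartedSpace EB (Shape G Q)]

/-- `π : Q → Q/G` is a smooth (left) principal `G`-bundle: the action is smooth and the manifold
`Q/G` is covered by open sets over which `Q` is smoothly and `G`-equivariantly isomorphic to a
product with `G`. (In particular the action is free, and the smooth structure of `Q/G` is the
quotient one.) -/
structure IsPrincipalBundle : Prop where
  contMDiff_smul : ContMDiff (𝓘(ℝ, EG).prod 𝓘(ℝ, E)) 𝓘(ℝ, E) ∞ (fun p : G × Q => p.1 • p.2)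
  exists_trivialization : ∀ b : Shape G Q, ∃ e : Bundle.Trivialization G (proj G Q), b ∈ e.baseSet ∧
    ContMDiffOn 𝓘(ℝ, E) (𝓘(ℝ, EB).prod 𝓘(ℝ, EG)) ∞ e e.source ∧
    ContMDiffOn (𝓘(ℝ, EB).prod 𝓘(ℝ, EG)) 𝓘(ℝ, E) ∞ e.toOpenPartialHomeomorph.symm e.target ∧
    ∀ (g : G) (q : Q), q ∈ e.source → (e (g • q)).2 = g * (e q).2

/-- The action of `G` on `Q × G` by `g · (q, w) = (g • q, g w g⁻¹)`. -/
abbrev conjAction : MulAction G (Q × G) where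
  smul g p := (g • p.1, g * p.2 * g⁻¹)
  one_smul p := by
    change ((1 : G) • p.1, (1 : G) * p.2 * (1 : G)⁻¹) = p
    simp
  mul_smul g g' p := by
    change ((g * g') • p.1, (g * g') * p.2 * (g * g')⁻¹)
      = (g • g' • p.1, g * (g' * p.2 * g'⁻¹) * g⁻¹)
    simp [mul_smul, mul_assoc]

/-- The orbit equivalence relation of the action of `G` on `Q × G`. -/
abbrev conjSetoid : Setoid (Q × G) :=
  letI := conjAction G Q
  MulAction.orbitRel G (Q × G)

end PrincipalBundle

section ConjBundle

variable {E EG EB G Q : Type*}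
  [NormedAddCommGroup E] [NormedSpace ℝ E] [NormedAddCommGroup EG] [NormedSpace ℝ EG]
  [NormedAddCommGroup EB] [NormedSpace ℝ EB]
  [TopologicalSpace G] [ChartedSpace EG G] [Group G]
  [TopologicalSpace Q] [ChartedSpace E Q] [MulAction G Q]

theorem proj_smul (g : G) (q : Q) : proj G Q (g • q) = proj G Q q :=
  Quotient.sound ⟨g, rfl⟩

theorem proj_eq_iff {q q' : Q} : proj G Q q = proj G Q q' ↔ ∃ g : G, g • q' = q :=
  ⟨fun h => Quotient.exact h, fun ⟨g, h⟩ => Quotient.sound ⟨g, h⟩⟩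

theorem conjSetoid_iff {p p' : Q × G} :
    (conjSetoid G Q).r p p' ↔ ∃ g : G, (g • p'.1, g * p'.2 * g⁻¹) = p := Iff.rfl

variable [ChartedSpace EB (Shape G Q)]

theorem IsPrincipalBundle.continuous_smul (h : IsPrincipalBundle E EG EB G Q) (g : G) :
    Continuous (fun q : Q => g • q) :=
  h.contMDiff_smul.continuous.comp (Continuous.prodMk_right g)

/-- The action in a principal bundle is free. -/
theorem IsPrincipalBundle.eq_one (h : IsPrincipalBundle E EG EB G Q) {g : G} {q : Q}
    (hg : g • q = q) : g = 1 := by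
  obtain ⟨e, he, -, -, heq⟩ := h.exists_trivialization (proj G Q q)
  have := heq g q (e.mem_source.2 he)
  rw [hg] at this
  exact (mul_eq_right.1 this.symm)

/-- The associated conjugate bundle `G̃ = (Q × G)/G`. -/
def ConjBundle (_h : IsPrincipalBundle E EG EB G Q) : Type _ := Quotient (conjSetoid G Q)

variable (h : IsPrincipalBundle E EG EB G Q)

instance : TopologicalSpace (ConjBundle h) :=
  inferInstanceAs (TopologicalSpace (Quotient (conjSetoid G Q)))

/-- The quotient map `ρ : Q × G → G̃`. -/
def rho (p : Q × G) : ConjBundle h := Quotient.mk (conjSetoid G Q) p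

theorem isQuotientMap_rho : Topology.IsQuotientMap (rho h) := isQuotientMap_quotient_mk'

theorem rho_eq_iff {p p' : Q × G} :
    rho h p = rho h p' ↔ ∃ g : G, (g • p'.1, g * p'.2 * g⁻¹) = p :=
  ⟨fun hh => Quotient.exact hh, fun hh => Quotient.sound hh⟩

theorem rho_conj (g : G) (q : Q) (w : G) : rho h (g • q, g * w * g⁻¹) = rho h (q, w) :=
  (rho_eq_iff h).2 ⟨g, rfl⟩

/-- The projection `G̃ → Q/G` induced by the first projection. -/
def ConjBundle.pr : ConjBundle h → Shape G Q :=
  Quotient.lift (fun p : Q × G => proj G Q p.1) (by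
    rintro p p' ⟨g, hg⟩
    change (g • p'.1, g * p'.2 * g⁻¹) = p at hg
    subst hg
    exact proj_smul g p'.1)

theorem pr_rho (p : Q × G) : ConjBundle.pr h (rho h p) = proj G Q p.1 := rfl

theorem continuous_proj : Continuous (proj G Q) := continuous_quotient_mk'

theorem continuous_pr : Continuous (ConjBundle.pr h) :=
  (isQuotientMap_rho h).continuous_iff.2 (continuous_proj.comp continuous_fst)

/-- A chosen smooth equivariant trivialization of `π` around `b`. -/
def triv (b : Shape G Q) : Bundle.Trivialization G (proj G Q) := (h.exists_trivialization b).choose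

theorem mem_triv (b : Shape G Q) : b ∈ (triv h b).baseSet :=
  (h.exists_trivialization b).choose_spec.1

theorem triv_contMDiffOn (b : Shape G Q) :
    ContMDiffOn 𝓘(ℝ, E) (𝓘(ℝ, EB).prod 𝓘(ℝ, EG)) ∞ (triv h b) (triv h b).source :=
  (h.exists_trivialization b).choose_spec.2.1

theorem triv_symm_contMDiffOn (b : Shape G Q) :
    ContMDiffOn (𝓘(ℝ, EB).prod 𝓘(ℝ, EG)) 𝓘(ℝ, E) ∞
      (triv h b).toOpenPartialHomeomorph.symm (triv h b).target :=
  (h.exists_trivialization b).choose_spec.2.2.1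

theorem triv_smul (b : Shape G Q) (g : G) {q : Q} (hq : proj G Q q ∈ (triv h b).baseSet) :
    (triv h b (g • q)).2 = g * (triv h b q).2 :=
  (h.exists_trivialization b).choose_spec.2.2.2 g q ((triv h b).mem_source.2 hq)

/-- The local section of `π` given by the chosen trivialization around `b`. -/
def sec (b x : Shape G Q) : Q := (triv h b).toOpenPartialHomeomorph.symm (x, 1)

theorem proj_sec (b : Shape G Q) {x : Shape G Q} (hx : x ∈ (triv h b).baseSet) :
    proj G Q (sec h b x) = x :=
  (triv h b).proj_symm_apply' hx

theorem triv_sec (b : Shape G Q) {x : Shape G Q} (hx : x ∈ (triv h b).baseSet) :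
    (triv h b (sec h b x)).2 = 1 := by
  have := (triv h b).apply_symm_apply' (b := x) (x := (1 : G)) hx
  simpa [sec] using congrArg Prod.snd this

theorem smul_sec (b : Shape G Q) {q : Q} (hq : proj G Q q ∈ (triv h b).baseSet) :
    (triv h b q).2 • sec h b (proj G Q q) = q := by
  have h1 : proj G Q (sec h b (proj G Q q)) ∈ (triv h b).baseSet := by rwa [proj_sec h b hq]
  have h2 : proj G Q ((triv h b q).2 • sec h b (proj G Q q)) ∈ (triv h b).baseSet := by
    rwa [proj_smul]
  apply (triv h b).injOn ((triv h b).mem_source.2 h2) ((triv h b).mem_source.2 hq)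
  change triv h b _ = triv h b _
  refine Prod.ext ?_ ?_
  · rw [(triv h b).coe_fst' h2, (triv h b).coe_fst' hq, proj_smul, proj_sec h b hq]
  · rw [triv_smul h b _ h1, triv_sec h b hq, mul_one]

open Classical in
/-- Over the base set of a trivialization of `π` with section `s`, the class of
`(s(x), w)` in `G̃` corresponds to `(x, w)`. -/
def conjTrivFun (b : Shape G Q) : ConjBundle h → Shape G Q × G :=
  Quotient.lift (fun p : Q × G =>
    (proj G Q p.1, if proj G Q p.1 ∈ (triv h b).baseSet then
      (triv h b p.1).2⁻¹ * p.2 * (triv h b p.1).2 else 1)) (by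
    rintro p p' ⟨g, hg⟩
    change (g • p'.1, g * p'.2 * g⁻¹) = p at hg
    subst hg
    by_cases hp : proj G Q p'.1 ∈ (triv h b).baseSet
    · simp [proj_smul, hp, triv_smul h b g hp, mul_assoc]
    · simp [proj_smul, hp])

theorem conjTrivFun_rho (b : Shape G Q) {p : Q × G} (hp : proj G Q p.1 ∈ (triv h b).baseSet) :
    conjTrivFun h b (rho h p) =
      (proj G Q p.1, (triv h b p.1).2⁻¹ * p.2 * (triv h b p.1).2) := by
  classical
  simp only [conjTrivFun, rho, Quotient.lift_mk]
  rw [if_pos hp]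

theorem exists_rho (v : ConjBundle h) : ∃ p, rho h p = v := Quotient.exists_rep v

section
variable [LieGroup 𝓘(ℝ, EG) ∞ G]

/-- The local trivialization of `G̃` induced by the trivialization of `π` around `b`. -/
def conjTriv (b : Shape G Q) : OpenPartialHomeomorph (ConjBundle h) (Shape G Q × G) where
  toFun := conjTrivFun h b
  invFun p := rho h (sec h b p.1, p.2)
  source := ConjBundle.pr h ⁻¹' (triv h b).baseSet
  target := (triv h b).baseSet ×ˢ univ
  map_source' := by
    intro v hv
    obtain ⟨p, rfl⟩ := exists_rho h v
    exact ⟨hv, trivial⟩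
  map_target' := by
    rintro ⟨x, w⟩ ⟨hx, -⟩
    have hx : x ∈ (triv h b).baseSet := hx
    change proj G Q (sec h b x) ∈ (triv h b).baseSet
    rwa [proj_sec h b hx]
  left_inv' := by
    intro v hv
    obtain ⟨⟨q, w⟩, rfl⟩ := exists_rho h v
    rw [conjTrivFun_rho h b hv]
    dsimp only
    have hq : proj G Q q ∈ (triv h b).baseSet := hv
    rw [← rho_conj h (triv h b q).2, smul_sec h b hq]
    simp [mul_assoc]
  right_inv' := by
    rintro ⟨x, w⟩ ⟨hx, -⟩
    dsimp only
    have hx' : x ∈ (triv h b).baseSet := hx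
    rw [conjTrivFun_rho h b (by rwa [proj_sec h b hx'])]
    simp [proj_sec h b hx', triv_sec h b hx']
  open_source := (triv h b).open_baseSet.preimage (continuous_pr h)
  open_target := (triv h b).open_baseSet.prod isOpen_univ
  continuousOn_toFun := by
    have : IsTopologicalGroup G := topologicalGroup_of_lieGroup 𝓘(ℝ, EG) ∞
    rw [(isQuotientMap_rho h).continuousOn_isOpen_iff
      ((triv h b).open_baseSet.preimage (continuous_pr h))]
    have hc : ContinuousOn (fun p : Q × G => (triv h b p.1).2)
        (rho h ⁻¹' (ConjBundle.pr h ⁻¹' (triv h b).baseSet)) := by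
      refine continuous_snd.comp_continuousOn
        ((triv h b).toOpenPartialHomeomorph.continuousOn.comp continuous_fst.continuousOn ?_)
      intro p hp
      exact (triv h b).mem_source.2 hp
    refine ContinuousOn.congr (f := fun p : Q × G =>
      (proj G Q p.1, (triv h b p.1).2⁻¹ * p.2 * (triv h b p.1).2)) ?_ ?_
    · exact (continuous_proj.comp continuous_fst).continuousOn.prodMk
        ((hc.inv.mul continuous_snd.continuousOn).mul hc)
    · intro p hp
      exact conjTrivFun_rho h b hp
  continuousOn_invFun := by
    refine (isQuotientMap_rho h).continuous.comp_continuousOn ?_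
    refine ContinuousOn.prodMk ?_ continuous_snd.continuousOn
    refine (triv h b).toOpenPartialHomeomorph.symm.continuousOn.comp
      (f := fun p : Shape G Q × G => (p.1, (1 : G))) (by fun_prop) ?_
    rintro p hp
    exact (triv h b).mem_target.2 hp.1

/-- The charts of `G̃`: a trivialization over an open set of `Q/G`, followed by charts of `Q/G`
and `G`. -/
def conjChart (x : Shape G Q × G) : OpenPartialHomeomorph (ConjBundle h) (ModelProd EB EG) :=
  (conjTriv h x.1).trans (chartAt (ModelProd EB EG) x)

/-- The smooth structure of the quotient `G̃ = (Q × G)/G`. -/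
instance : ChartedSpace (ModelProd EB EG) (ConjBundle h) where
  atlas := range (conjChart h)
  chartAt v := conjChart h (conjTriv h (ConjBundle.pr h v) v)
  mem_chart_source v := by
    have hb : (conjTriv h (ConjBundle.pr h v) v).1 = ConjBundle.pr h v := by
      obtain ⟨p, rfl⟩ := exists_rho h v
      rfl
    have := mem_triv h (ConjBundle.pr h v)
    rw [conjChart, hb]
    exact ⟨this, mem_chart_source (ModelProd EB EG) (conjTriv h (ConjBundle.pr h v) v)⟩
  chart_mem_atlas v := ⟨_, rfl⟩

theorem conjTriv_symm_trans_contMDiffOn (b b' : Shape G Q) :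
    ContMDiffOn (𝓘(ℝ, EB).prod 𝓘(ℝ, EG)) (𝓘(ℝ, EB).prod 𝓘(ℝ, EG)) ∞
      ((conjTriv h b).symm.trans (conjTriv h b'))
      ((conjTriv h b).symm.trans (conjTriv h b')).source := by
  have hsub : ∀ p ∈ ((conjTriv h b).symm.trans (conjTriv h b')).source,
      p.1 ∈ (triv h b).baseSet ∧ p.1 ∈ (triv h b').baseSet := by
    rintro ⟨x, w⟩ ⟨hx, hx'⟩
    have h1 : x ∈ (triv h b).baseSet := hx.1
    have h2 : proj G Q (sec h b x) ∈ (triv h b').baseSet := hx'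
    rw [proj_sec h b h1] at h2
    exact ⟨h1, h2⟩
  have hs : ContMDiffOn (𝓘(ℝ, EB).prod 𝓘(ℝ, EG)) 𝓘(ℝ, E) ∞
      (fun p : Shape G Q × G => sec h b p.1)
      ((conjTriv h b).symm.trans (conjTriv h b')).source := by
    refine (triv_symm_contMDiffOn h b).comp (f := fun p : Shape G Q × G => (p.1, (1 : G)))
      (contMDiff_fst.prodMk contMDiff_const).contMDiffOn ?_
    intro p hp
    exact (triv h b).mem_target.2 (hsub p hp).1
  have hc : ContMDiffOn (𝓘(ℝ, EB).prod 𝓘(ℝ, EG)) 𝓘(ℝ, EG) ∞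
      (fun p : Shape G Q × G => (triv h b' (sec h b p.1)).2)
      ((conjTriv h b).symm.trans (conjTriv h b')).source := by
    refine contMDiff_snd.comp_contMDiffOn ((triv_contMDiffOn h b').comp hs ?_)
    intro p hp
    refine (triv h b').mem_source.2 ?_
    rw [proj_sec h b (hsub p hp).1]
    exact (hsub p hp).2
  refine ContMDiffOn.congr (f := fun p : Shape G Q × G =>
    (p.1, (triv h b' (sec h b p.1)).2⁻¹ * p.2 * (triv h b' (sec h b p.1)).2)) ?_ ?_
  · exact contMDiff_fst.contMDiffOn.prodMk ((hc.inv.mul contMDiff_snd.contMDiffOn).mul hc)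
  · intro p hp
    change conjTrivFun h b' (rho h (sec h b p.1, p.2)) = _
    have := proj_sec h b (hsub p hp).1
    rw [conjTrivFun_rho h b' (by rw [this]; exact (hsub p hp).2), this]

instance [IsManifold 𝓘(ℝ, EB) ∞ (Shape G Q)] :
    IsManifold (𝓘(ℝ, EB).prod 𝓘(ℝ, EG)) ∞ (ConjBundle h) := by
  have : IsManifold 𝓘(ℝ, EG) ∞ G := inferInstance
  apply isManifold_of_contDiffOn
  rintro _ _ ⟨x, rfl⟩ ⟨y, rfl⟩
  have key : ContMDiffOn (𝓘(ℝ, EB).prod 𝓘(ℝ, EG)) (𝓘(ℝ, EB).prod 𝓘(ℝ, EG)) ∞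
      ((conjChart h x).symm.trans (conjChart h y))
      ((conjChart h x).symm.trans (conjChart h y)).source := by
    have hx := contMDiffOn_chart_symm (I := 𝓘(ℝ, EB).prod 𝓘(ℝ, EG)) (n := ∞) (x := x)
    have hy := contMDiffOn_chart (I := 𝓘(ℝ, EB).prod 𝓘(ℝ, EG)) (n := ∞) (x := y)
    refine (hy.comp ((conjTriv_symm_trans_contMDiffOn h x.1 y.1).comp
      (s := ((conjChart h x).symm.trans (conjChart h y)).source) (hx.mono ?_) ?_) ?_)
    · intro p hp
      exact hp.1.1
    · intro p hp
      exact ⟨hp.1.2, hp.2.1⟩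
    · intro p hp
      exact hp.2.2
  rw [← modelWithCornersSelf_prod] at key ⊢
  have key' : ContDiffOn (E := EB × EG) (F := EB × EG) ℝ ∞
      ((conjChart h x).symm.trans (conjChart h y))
      ((conjChart h x).symm.trans (conjChart h y)).source :=
    contMDiffOn_iff_contDiffOn.1 key
  refine key'.mono ?_
  rintro p ⟨hp, -⟩
  exact hp

end

end ConjBundle

/-! ### Product manifolds, submanifolds and subbundles -/

section Calculus

variable {E₁ H₁ M₁ E₂ H₂ M₂ : Type*}
  [NormedAddCommGroup E₁] [NormedSpace ℝ E₁] [TopologicalSpace H₁]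
  [TopologicalSpace M₁] [ChartedSpace H₁ M₁]
  [NormedAddCommGroup E₂] [NormedSpace ℝ E₂] [TopologicalSpace H₂]
  [TopologicalSpace M₂] [ChartedSpace H₂ M₂]
  (I₁ : ModelWithCorners ℝ E₁ H₁) (I₂ : ModelWithCorners ℝ E₂ H₂)

/-- The inclusion `v ↦ (v, 0)` of `T_x M₁` in `T_(x,y) (M₁ × M₂)`. -/
def inlT (x : M₁) (y : M₂) : TangentSpace I₁ x →L[ℝ] TangentSpace (I₁.prod I₂) (x, y) :=
  ContinuousLinearMap.inl ℝ E₁ E₂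

/-- The inclusion `v ↦ (0, v)` of `T_y M₂` in `T_(x,y) (M₁ × M₂)`. -/
def inrT (x : M₁) (y : M₂) : TangentSpace I₂ y →L[ℝ] TangentSpace (I₁.prod I₂) (x, y) :=
  ContinuousLinearMap.inr ℝ E₁ E₂

/-- The tangent vector `(v, w)` of a product manifold. -/
def pairT {x : M₁} {y : M₂} (v : TangentSpace I₁ x) (w : TangentSpace I₂ y) :
    TangentSpace (I₁.prod I₂) (x, y) :=
  inlT I₁ I₂ x y v + inrT I₁ I₂ x y w

/-- `S` is an embedded (regular) submanifold: near each of its points there is a slice chart. -/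
def IsEmbeddedSubmanifold (S : Set M₁) : Prop :=
  ∀ x ∈ S, ∃ φ ∈ IsManifold.maximalAtlas I₁ ∞ M₁, x ∈ φ.source ∧
    ∃ W : Submodule ℝ E₁, ∀ y ∈ φ.source, y ∈ S ↔ φ.extend I₁ y ∈ W

/-- The family `D` of subspaces of the tangent spaces is a smooth subbundle of the tangent bundle:
locally it is spanned by a smooth frame. -/
def IsSmoothSubbundle [IsManifold I₁ 1 M₁] (D : ∀ x : M₁, Submodule ℝ (TangentSpace I₁ x)) :
    Prop :=
  ∀ x₀ : M₁, ∃ V : Set M₁, IsOpen V ∧ x₀ ∈ V ∧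
    ∃ (r : ℕ) (X : Fin r → ∀ x : M₁, TangentSpace I₁ x),
      (∀ i, ContMDiffOn I₁ I₁.tangent ∞ (fun x => (⟨x, X i x⟩ : TangentBundle I₁ M₁)) V) ∧
      ∀ x ∈ V, LinearIndependent ℝ (fun i => X i x) ∧
        Submodule.span ℝ (range fun i => X i x) = D x

end Calculus

/-! ### Nonholonomic discrete mechanical systems with symmetry -/

section System

variable (E G Q : Type*)
  [NormedAddCommGroup E] [NormedSpace ℝ E]
  [TopologicalSpace Q] [ChartedSpace E Q] [IsManifold 𝓘(ℝ, E) ∞ Q]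

/-- A nonholonomic discrete mechanical system `(Q, L_d, 𝒟, 𝒟_d)`: the discrete Lagrangian `L`, the
variational constraints `D` and the discrete kinematic constraints `Dd`. -/
structure NonholonomicDMS where
  L : Q × Q → ℝ
  contMDiff_L : ContMDiff (𝓘(ℝ, E).prod 𝓘(ℝ, E)) 𝓘(ℝ, ℝ) ∞ L
  D : ∀ q : Q, Submodule ℝ (TangentSpace 𝓘(ℝ, E) q)
  isSmoothSubbundle_D : IsSmoothSubbundle 𝓘(ℝ, E) D
  Dd : Set (Q × Q)
  isEmbeddedSubmanifold_Dd : IsEmbeddedSubmanifold (𝓘(ℝ, E).prod 𝓘(ℝ, E)) Dd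

variable {E Q} [Group G] [MulAction G Q]

/-- The family `D` of subspaces of the tangent spaces is invariant under the lifted action. -/
def IsInvariantDistribution (D : ∀ q : Q, Submodule ℝ (TangentSpace 𝓘(ℝ, E) q)) : Prop :=
  ∀ (g : G) (q : Q), ∀ v ∈ D q, mfderiv 𝓘(ℝ, E) 𝓘(ℝ, E) (fun x : Q => g • x) q v ∈ D (g • q)

/-- `G` is a symmetry group of the nonholonomic system `S`. (That `Q → Q/G` is a principal bundle
is the separate condition `IsPrincipalBundle`.) -/
structure IsSymmetryGroup (S : NonholonomicDMS E Q) : Prop where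
  L_smul : ∀ (g : G) (q₀ q₁ : Q), S.L (g • q₀, g • q₁) = S.L (q₀, q₁)
  Dd_smul : ∀ (g : G) (q₀ q₁ : Q), (q₀, q₁) ∈ S.Dd → (g • q₀, g • q₁) ∈ S.Dd
  D_smul : IsInvariantDistribution G S.D

variable {G}

/-- The discrete action `S_d(q.) = ∑ L_d(q_k, q_{k+1})` of discrete curves `q_0, …, q_N`. -/
def NonholonomicDMS.action (S : NonholonomicDMS E Q) (N : ℕ) (q : Fin (N + 1) → Q) : ℝ :=
  ∑ k : Fin N, S.L (q k.castSucc, q k.succ)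

/-- The differential `dS_d(q.)(δq.)` of the discrete action on the manifold `Q^(N+1)`. -/
def NonholonomicDMS.dAction (S : NonholonomicDMS E Q) {N : ℕ} (q : Fin (N + 1) → Q)
    (δq : ∀ k, TangentSpace 𝓘(ℝ, E) (q k)) : ℝ :=
  mfderiv (ModelWithCorners.pi fun _ : Fin (N + 1) => 𝓘(ℝ, E)) 𝓘(ℝ, ℝ) (S.action N) q
    (show TangentSpace (ModelWithCorners.pi fun _ : Fin (N + 1) => 𝓘(ℝ, E)) q from
      fun k => δq k)

/-- `D₁L_d(q₀, q₁) ∈ T*_{q₀} Q`. -/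
def NonholonomicDMS.D₁L (S : NonholonomicDMS E Q) (q₀ q₁ : Q) : TangentSpace 𝓘(ℝ, E) q₀ →L[ℝ] ℝ :=
  (mfderiv (𝓘(ℝ, E).prod 𝓘(ℝ, E)) 𝓘(ℝ, ℝ) S.L (q₀, q₁)).comp (inlT 𝓘(ℝ, E) 𝓘(ℝ, E) q₀ q₁)

/-- `D₂L_d(q₀, q₁) ∈ T*_{q₁} Q`. -/
def NonholonomicDMS.D₂L (S : NonholonomicDMS E Q) (q₀ q₁ : Q) : TangentSpace 𝓘(ℝ, E) q₁ →L[ℝ] ℝ :=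
  (mfderiv (𝓘(ℝ, E).prod 𝓘(ℝ, E)) 𝓘(ℝ, ℝ) S.L (q₀, q₁)).comp (inrT 𝓘(ℝ, E) 𝓘(ℝ, E) q₀ q₁)

end System

/-! ### Connections -/

section Connections

variable {E EG EB G Q : Type*}
  [NormedAddCommGroup E] [NormedSpace ℝ E] [NormedAddCommGroup EG] [NormedSpace ℝ EG]
  [NormedAddCommGroup EB] [NormedSpace ℝ EB]
  [TopologicalSpace G] [ChartedSpace EG G] [Group G]
  [TopologicalSpace Q] [ChartedSpace E Q] [IsManifold 𝓘(ℝ, E) ∞ Q] [MulAction G Q]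
  [ChartedSpace EB (Shape G Q)]

/-- The tangent map `T_q π : T_q Q → T_{π(q)} (Q/G)`. -/
def tangentProj (_h : IsPrincipalBundle E EG EB G Q) (q : Q) :
    TangentSpace 𝓘(ℝ, E) q →L[ℝ] TangentSpace 𝓘(ℝ, EB) (proj G Q q) :=
  mfderiv 𝓘(ℝ, E) 𝓘(ℝ, EB) (proj G Q) q

/-- The infinitesimal generators: `ξ ↦ ξ_Q(q)`, the tangent map at the identity of the orbit map
`g ↦ g • q`. -/
def infGen (_h : IsPrincipalBundle E EG EB G Q) (q : Q) :
    GroupLieAlgebra 𝓘(ℝ, EG) G →L[ℝ] TangentSpace 𝓘(ℝ, E) q :=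
  mfderiv 𝓘(ℝ, EG) 𝓘(ℝ, E) (fun g : G => g • q) 1

/-- The vertical space `𝒱_q = ker T_q π`. -/
def vertical (h : IsPrincipalBundle E EG EB G Q) (q : Q) :
    Submodule ℝ (TangentSpace 𝓘(ℝ, E) q) :=
  LinearMap.ker (tangentProj h q).toLinearMap

/-- An affine discrete connection on `π : Q → Q/G` which is defined on the whole of `Q × Q`
(field `total`): the `G`-invariant embedded submanifold `Hor` contains the graph of
`q ↦ γ(q) • q`, where `γ` is the level function `level`, and the restriction to `Hor` of
`id × π : Q × Q → Q × Q/G` is injective and a local diffeomorphism, that is, it has smooth local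
inverses. -/
structure AffineDiscreteConnection (h : IsPrincipalBundle E EG EB G Q) where
  level : Q → G
  contMDiff_level : ContMDiff 𝓘(ℝ, E) 𝓘(ℝ, EG) ∞ level
  level_smul : ∀ (g : G) (q : Q), level (g • q) = g * level q * g⁻¹
  Hor : Set (Q × Q)
  isEmbeddedSubmanifold_Hor : IsEmbeddedSubmanifold (𝓘(ℝ, E).prod 𝓘(ℝ, E)) Hor
  level_mem : ∀ q : Q, (q, level q • q) ∈ Hor
  smul_mem : ∀ (g : G) (q₀ q₁ : Q), (q₀, q₁) ∈ Hor → (g • q₀, g • q₁) ∈ Hor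
  injOn : InjOn (fun p : Q × Q => (p.1, proj G Q p.2)) Hor
  local_inverse : ∀ p ∈ Hor, ∃ V : Set (Q × Shape G Q), IsOpen V ∧ (p.1, proj G Q p.2) ∈ V ∧
    ∃ σ : Q × Shape G Q → Q × Q,
      ContMDiffOn (𝓘(ℝ, E).prod 𝓘(ℝ, EB)) (𝓘(ℝ, E).prod 𝓘(ℝ, E)) ∞ σ V ∧
      ∀ x ∈ V, σ x ∈ Hor ∧ ((σ x).1, proj G Q (σ x).2) = x
  total : ∀ q₀ q₁ : Q, ∃ g : G, (q₀, g⁻¹ • q₁) ∈ Hor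

namespace AffineDiscreteConnection

variable {h : IsPrincipalBundle E EG EB G Q} (A : AffineDiscreteConnection h)

/-- The affine discrete connection form `𝒜_d : Q × Q → G`: `𝒜_d(q₀, q₁)` is the unique `g` with
`(q₀, g⁻¹ • q₁) ∈ Hor`. -/
def form (p : Q × Q) : G := (A.total p.1 p.2).choose

theorem form_spec (q₀ q₁ : Q) : (q₀, (A.form (q₀, q₁))⁻¹ • q₁) ∈ A.Hor :=
  (A.total q₀ q₁).choose_spec

theorem form_unique {q₀ q₁ : Q} {g g' : G} (hg : (q₀, g⁻¹ • q₁) ∈ A.Hor)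
    (hg' : (q₀, g'⁻¹ • q₁) ∈ A.Hor) : g = g' := by
  have := A.injOn hg hg' (by simp [proj_smul])
  have h1 : g⁻¹ • q₁ = g'⁻¹ • q₁ := congrArg Prod.snd this
  have h2 : (g' * g⁻¹) • q₁ = q₁ := by rw [mul_smul, h1, smul_inv_smul]
  exact (mul_inv_eq_one.1 (h.eq_one h2)).symm

theorem form_smul (g : G) (q₀ q₁ : Q) :
    A.form (g • q₀, g • q₁) = g * A.form (q₀, q₁) * g⁻¹ := by
  refine A.form_unique (A.form_spec _ _) ?_
  have := A.smul_mem g _ _ (A.form_spec q₀ q₁)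
  simpa [mul_smul] using this

theorem exists_hor (q : Q) (τ : Shape G Q) : ∃ q₁ : Q, (q, q₁) ∈ A.Hor ∧ proj G Q q₁ = τ := by
  obtain ⟨q', rfl⟩ := Quotient.exists_rep τ
  exact ⟨_, A.form_spec q q', proj_smul _ _⟩

/-- The (second component of the) affine discrete horizontal lift: the unique `q₁` with
`(q, q₁) ∈ Hor` and `π(q₁) = τ`. -/
def lift (q : Q) (τ : Shape G Q) : Q := (A.exists_hor q τ).choose

theorem lift_spec (q : Q) (τ : Shape G Q) : (q, A.lift q τ) ∈ A.Hor ∧ proj G Q (A.lift q τ) = τ :=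
  (A.exists_hor q τ).choose_spec

theorem lift_smul (g : G) (q : Q) (τ : Shape G Q) : A.lift (g • q) τ = g • A.lift q τ := by
  have := A.injOn (A.lift_spec (g • q) τ).1 (A.smul_mem g _ _ (A.lift_spec q τ).1)
    (by simp [proj_smul, (A.lift_spec _ _).2])
  exact congrArg Prod.snd this

/-- `F̃₁(q, w, τ) = w • lift q τ`; the map `(q, w, τ) ↦ (q, F̃₁(q, w, τ))` is the inverse of
`(q₀, q₁) ↦ (q₀, 𝒜_d(q₀, q₁), π(q₁))`. -/
def F₁ (x : Q × G × Shape G Q) : Q := x.2.1 • A.lift x.1 x.2.2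

/-- The map `Φ : (Q × Q)/G → G̃ × Q/G` induced by `(q₀, q₁) ↦ (ρ(q₀, 𝒜_d(q₀, q₁)), π(q₁))`. -/
def Phi : MulAction.orbitRel.Quotient G (Q × Q) → ConjBundle h × Shape G Q :=
  Quotient.lift (fun p : Q × Q => (rho h (p.1, A.form p), proj G Q p.2)) (by
    rintro p ⟨q₀, q₁⟩ ⟨g, hg⟩
    change (g • q₀, g • q₁) = p at hg
    subst hg
    simp only [form_smul, rho_conj, proj_smul])

/-- The reduced kinematic constraints `Φ(𝒟_d/G)`. -/
def reducedDd (S : NonholonomicDMS E Q) : Set (ConjBundle h × Shape G Q) :=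
  A.Phi '' (Quotient.mk (MulAction.orbitRel G (Q × Q)) '' S.Dd)

/-- The function `Ľ_d : Q × G × Q/G → ℝ`. -/
def Lcheck (S : NonholonomicDMS E Q) (x : Q × G × Shape G Q) : ℝ := S.L (x.1, A.F₁ x)

theorem Lcheck_smul (S : NonholonomicDMS E Q) (hS : IsSymmetryGroup G S) (g : G) (q : Q) (w : G)
    (τ : Shape G Q) : A.Lcheck S (g • q, g * w * g⁻¹, τ) = A.Lcheck S (q, w, τ) := by
  simp [Lcheck, F₁, lift_smul, mul_smul, hS.L_smul]

/-- The reduced Lagrangian `L̂_d : G̃ × Q/G → ℝ`, `L̂_d(ρ(q, w), τ) = Ľ_d(q, w, τ)`. -/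
def Lhat (S : NonholonomicDMS E Q) (hS : IsSymmetryGroup G S) (x : ConjBundle h × Shape G Q) : ℝ :=
  Quotient.lift (fun p : Q × G => A.Lcheck S (p.1, p.2, x.2)) (by
    rintro p ⟨q, w⟩ ⟨g, hg⟩
    change (g • q, g * w * g⁻¹) = p at hg
    subst hg
    exact A.Lcheck_smul S hS g q w x.2) x.1

/-- The tangent map `T_(q₀,q₁) 𝒜_d`. -/
def tangentForm (q₀ q₁ : Q) : TangentSpace (𝓘(ℝ, E).prod 𝓘(ℝ, E)) (q₀, q₁) →L[ℝ]
    TangentSpace 𝓘(ℝ, EG) (A.form (q₀, q₁)) :=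
  mfderiv (𝓘(ℝ, E).prod 𝓘(ℝ, E)) 𝓘(ℝ, EG) A.form (q₀, q₁)

/-- `D₁Ľ_d(q₀, w₀, τ₁) ∈ T*_{q₀} Q`. -/
def D₁Lcheck (S : NonholonomicDMS E Q) (q₀ : Q) (w₀ : G) (τ₁ : Shape G Q) :
    TangentSpace 𝓘(ℝ, E) q₀ →L[ℝ] ℝ :=
  (mfderiv (𝓘(ℝ, E).prod (𝓘(ℝ, EG).prod 𝓘(ℝ, EB))) 𝓘(ℝ, ℝ) (A.Lcheck S) (q₀, w₀, τ₁)).comp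
    (inlT 𝓘(ℝ, E) (𝓘(ℝ, EG).prod 𝓘(ℝ, EB)) q₀ (w₀, τ₁))

/-- `D₂Ľ_d(q₀, w₀, τ₁) ∈ T*_{w₀} G`. -/
def D₂Lcheck (S : NonholonomicDMS E Q) (q₀ : Q) (w₀ : G) (τ₁ : Shape G Q) :
    TangentSpace 𝓘(ℝ, EG) w₀ →L[ℝ] ℝ :=
  (mfderiv (𝓘(ℝ, E).prod (𝓘(ℝ, EG).prod 𝓘(ℝ, EB))) 𝓘(ℝ, ℝ) (A.Lcheck S) (q₀, w₀, τ₁)).comp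
    ((inrT 𝓘(ℝ, E) (𝓘(ℝ, EG).prod 𝓘(ℝ, EB)) q₀ (w₀, τ₁)).comp
      (inlT 𝓘(ℝ, EG) 𝓘(ℝ, EB) w₀ τ₁))

/-- `D₃Ľ_d(q₀, w₀, τ₁) ∈ T*_{τ₁} (Q/G)`. -/
def D₃Lcheck (S : NonholonomicDMS E Q) (q₀ : Q) (w₀ : G) (τ₁ : Shape G Q) :
    TangentSpace 𝓘(ℝ, EB) τ₁ →L[ℝ] ℝ :=
  (mfderiv (𝓘(ℝ, E).prod (𝓘(ℝ, EG).prod 𝓘(ℝ, EB))) 𝓘(ℝ, ℝ) (A.Lcheck S) (q₀, w₀, τ₁)).comp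
    ((inrT 𝓘(ℝ, E) (𝓘(ℝ, EG).prod 𝓘(ℝ, EB)) q₀ (w₀, τ₁)).comp
      (inrT 𝓘(ℝ, EG) 𝓘(ℝ, EB) w₀ τ₁))

end AffineDiscreteConnection

/-- The data of a nonholonomic connection: a decomposition `TQ = W ⊕ U ⊕ 𝒮 ⊕ H` in `G`-invariant
subbundles, where `𝒮 = 𝒱 ∩ 𝒟`, `𝒟 = 𝒮 ⊕ H` and `𝒱 = 𝒮 ⊕ U`. -/
structure NonholonomicConnection (h : IsPrincipalBundle E EG EB G Q) (S : NonholonomicDMS E Q) where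
  W : ∀ q : Q, Submodule ℝ (TangentSpace 𝓘(ℝ, E) q)
  U : ∀ q : Q, Submodule ℝ (TangentSpace 𝓘(ℝ, E) q)
  H : ∀ q : Q, Submodule ℝ (TangentSpace 𝓘(ℝ, E) q)
  isSmoothSubbundle_W : IsSmoothSubbundle 𝓘(ℝ, E) W
  isSmoothSubbundle_U : IsSmoothSubbundle 𝓘(ℝ, E) U
  isSmoothSubbundle_H : IsSmoothSubbundle 𝓘(ℝ, E) H
  isSmoothSubbundle_inf : IsSmoothSubbundle 𝓘(ℝ, E) (fun q => vertical h q ⊓ S.D q)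
  W_smul : IsInvariantDistribution G W
  U_smul : IsInvariantDistribution G U
  H_smul : IsInvariantDistribution G H
  isInternal : ∀ q : Q, DirectSum.IsInternal ![W q, U q, vertical h q ⊓ S.D q, H q]
  D_eq : ∀ q : Q, S.D q = (vertical h q ⊓ S.D q) ⊔ H q
  vertical_eq : ∀ q : Q, vertical h q = (vertical h q ⊓ S.D q) ⊔ U q

namespace NonholonomicConnection

variable {h : IsPrincipalBundle E EG EB G Q} {S : NonholonomicDMS E Q}

/-- The horizontal space of the connection, which is complementary to the vertical space
`𝒱 = 𝒮 ⊕ U`. -/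
def horizontal (C : NonholonomicConnection h S) (q : Q) : Submodule ℝ (TangentSpace 𝓘(ℝ, E) q) :=
  C.W q ⊔ C.H q

/-- The horizontal lift `h^q : T_{π(q)} (Q/G) → T_q Q`: the inverse of the isomorphism induced by
`T_q π` from the horizontal space at `q` onto `T_{π(q)} (Q/G)`. -/
def horLift (C : NonholonomicConnection h S) (q : Q) :
    TangentSpace 𝓘(ℝ, EB) (proj G Q q) →L[ℝ] TangentSpace 𝓘(ℝ, E) q :=
  (C.horizontal q).subtypeL.comp
    (ContinuousLinearMap.inverse ((tangentProj h q).comp (C.horizontal q).subtypeL))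

end NonholonomicConnection

/-- The fibre at `q` of `𝔤^𝒟`: the elements `ξ` of the Lie algebra with `ξ_Q(q) ∈ 𝒟_q`. -/
def gD (h : IsPrincipalBundle E EG EB G Q) (S : NonholonomicDMS E Q) (q : Q) :
    Submodule ℝ (GroupLieAlgebra 𝓘(ℝ, EG) G) :=
  (S.D q).comap (infGen h q).toLinearMap

/-- The reduced variational constraints `𝒟̂_{π(q)} = T_q π (𝒟_q)`. -/
def reducedD (h : IsPrincipalBundle E EG EB G Q) (S : NonholonomicDMS E Q) (q : Q) :
    Submodule ℝ (TangentSpace 𝓘(ℝ, EB) (proj G Q q)) :=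
  (S.D q).map (tangentProj h q).toLinearMap

end Connections

/-! ### Reduced dynamics -/

section Reduced

variable {E EG EB G Q : Type*}
  [NormedAddCommGroup E] [NormedSpace ℝ E] [NormedAddCommGroup EG] [NormedSpace ℝ EG]
  [NormedAddCommGroup EB] [NormedSpace ℝ EB]
  [TopologicalSpace G] [ChartedSpace EG G] [Group G] [LieGroup 𝓘(ℝ, EG) ∞ G]
  [TopologicalSpace Q] [ChartedSpace E Q] [IsManifold 𝓘(ℝ, E) ∞ Q] [MulAction G Q]
  [ChartedSpace EB (Shape G Q)]
  {h : IsPrincipalBundle E EG EB G Q} {S : NonholonomicDMS E Q}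
  (A : AffineDiscreteConnection h)

/-- The reduced curve: for `k = 0, …, N - 1` the pair `(v_k, τ_{k+1})`, where
`v_k = ρ(q_k, 𝒜_d(q_k, q_{k+1}))` and `τ_{k+1} = π(q_{k+1})`. -/
def reducedCurve {N : ℕ} (q : Fin (N + 1) → Q) (k : Fin N) : ConjBundle h × Shape G Q :=
  (rho h (q k.castSucc, A.form (q k.castSucc, q k.succ)), proj G Q (q k.succ))

/-- The reduced action `Ŝ_d(v., τ.) = ∑ L̂_d(v_k, τ_{k+1})`. -/
def reducedAction (hS : IsSymmetryGroup G S) (N : ℕ) (c : Fin N → ConjBundle h × Shape G Q) : ℝ :=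
  ∑ k : Fin N, A.Lhat S hS (c k)

/-- The differential `dŜ_d(v., τ.)(δv., δτ.)` of the reduced action on the manifold
`(G̃ × Q/G)^N`. -/
def dReducedAction (hS : IsSymmetryGroup G S) {N : ℕ} (c : Fin N → ConjBundle h × Shape G Q)
    (δv : ∀ k, TangentSpace (𝓘(ℝ, EB).prod 𝓘(ℝ, EG)) (c k).1)
    (δτ : ∀ k, TangentSpace 𝓘(ℝ, EB) (c k).2) : ℝ :=
  mfderiv (ModelWithCorners.pi fun _ : Fin N => (𝓘(ℝ, EB).prod 𝓘(ℝ, EG)).prod 𝓘(ℝ, EB)) 𝓘(ℝ, ℝ)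
    (reducedAction A hS N) c
    (show TangentSpace
        (ModelWithCorners.pi fun _ : Fin N => (𝓘(ℝ, EB).prod 𝓘(ℝ, EG)).prod 𝓘(ℝ, EB)) c from
      fun k => pairT (𝓘(ℝ, EB).prod 𝓘(ℝ, EG)) 𝓘(ℝ, EB) (δv k) (δτ k))

/-- The vector `T_(q₀,w₀) ρ (δq₀, T_(q₀,q₁) 𝒜_d (δq₀, δq₁))`, where `w₀ = 𝒜_d(q₀, q₁)`. -/
def tangentRhoForm (q₀ q₁ : Q) (δq₀ : TangentSpace 𝓘(ℝ, E) q₀) (δq₁ : TangentSpace 𝓘(ℝ, E) q₁) :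
    TangentSpace (𝓘(ℝ, EB).prod 𝓘(ℝ, EG)) (rho h (q₀, A.form (q₀, q₁))) :=
  mfderiv (𝓘(ℝ, E).prod 𝓘(ℝ, EG)) (𝓘(ℝ, EB).prod 𝓘(ℝ, EG)) (rho h) (q₀, A.form (q₀, q₁))
    (pairT 𝓘(ℝ, E) 𝓘(ℝ, EG) δq₀
      (A.tangentForm q₀ q₁ (pairT 𝓘(ℝ, E) 𝓘(ℝ, E) δq₀ δq₁)))

variable (C : NonholonomicConnection h S)

/-- The component `f̂_d⁻(v₀, τ₁)` at `(v₀, τ₁) = (ρ(q₀, 𝒜_d(q₀, q₁)), π(q₁))`, that is,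
`δτ₀ ↦ D₂Ľ_d(q₀, w₀, τ₁) T_(q₀,q₁) 𝒜_d (h^{q₀}(δτ₀), 0)`. -/
def forceMinus (q₀ q₁ : Q) : TangentSpace 𝓘(ℝ, EB) (proj G Q q₀) →L[ℝ] ℝ :=
  (A.D₂Lcheck S q₀ (A.form (q₀, q₁)) (proj G Q q₁)).comp
    ((A.tangentForm q₀ q₁).comp ((inlT 𝓘(ℝ, E) 𝓘(ℝ, E) q₀ q₁).comp (C.horLift q₀)))

/-- The component `f̂_d⁺(v₀, τ₁)` at `(v₀, τ₁) = (ρ(q₀, 𝒜_d(q₀, q₁)), π(q₁))`, that is,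
`δτ₁ ↦ D₂Ľ_d(q₀, w₀, τ₁) T_(q₀,q₁) 𝒜_d (0, h^{q₁}(δτ₁))`. -/
def forcePlus (q₀ q₁ : Q) : TangentSpace 𝓘(ℝ, EB) (proj G Q q₁) →L[ℝ] ℝ :=
  (A.D₂Lcheck S q₀ (A.form (q₀, q₁)) (proj G Q q₁)).comp
    ((A.tangentForm q₀ q₁).comp ((inrT 𝓘(ℝ, E) 𝓘(ℝ, E) q₀ q₁).comp (C.horLift q₁)))

/-- The covector `φ ∈ T*_{τ₁} (Q/G)` of three consecutive points `q₀, q₁, q₂` of a curve. -/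
def phi (q₀ q₁ q₂ : Q) : TangentSpace 𝓘(ℝ, EB) (proj G Q q₁) →L[ℝ] ℝ :=
  (A.D₁Lcheck S q₁ (A.form (q₁, q₂)) (proj G Q q₂)).comp (C.horLift q₁)
    + A.D₃Lcheck S q₀ (A.form (q₀, q₁)) (proj G Q q₁)
    + forceMinus A C q₁ q₂ + forcePlus A C q₀ q₁

/-- The right translation `ξ ↦ ξ w` from the Lie algebra to `T_w G`. -/
def rightTranslate (w : G) : GroupLieAlgebra 𝓘(ℝ, EG) G →L[ℝ] TangentSpace 𝓘(ℝ, EG) w :=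
  mfderiv 𝓘(ℝ, EG) 𝓘(ℝ, EG) (fun x : G => x * w) 1

variable (S)

/-- The covector `ψ ∈ 𝔤*` of three consecutive points `q₀, q₁, q₂` of a curve,
`ψ = D₂Ľ_d(q₀, w₀, τ₁) w₀⁻¹ - D₂Ľ_d(q₁, w₁, τ₂) w₁⁻¹`; here `(α w⁻¹)(ξ) = α(ξ w)` for a covector
`α` at `w`. -/
def psi (q₀ q₁ q₂ : Q) : GroupLieAlgebra 𝓘(ℝ, EG) G →L[ℝ] ℝ :=
  (A.D₂Lcheck S q₀ (A.form (q₀, q₁)) (proj G Q q₁)).comp (rightTranslate (A.form (q₀, q₁)))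
    - (A.D₂Lcheck S q₁ (A.form (q₁, q₂)) (proj G Q q₂)).comp (rightTranslate (A.form (q₁, q₂)))

end Reduced

end DiscreteReduction

end

open DiscreteReduction

/-!
# Nonholonomic discrete reduction

The discrete Lagrangian factors in two ways through the affine discrete connection,
`L_d(q₀, q₁) = Ľ_d(q₀, 𝒜_d(q₀, q₁), π(q₁)) = L̂_d(ρ(q₀, 𝒜_d(q₀, q₁)), π(q₁))`,
and every map involved is smooth: the horizontal lift because `(id × π)|_Hor` is injective with
smooth local inverses (`AffineDiscreteConnection.contMDiff_lift`), the form `𝒜_d` because it is a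
quotient of two group coordinates in a trivialization of `π`
(`AffineDiscreteConnection.contMDiff_form`), and `ρ` and `L̂_d` because the trivializations of `π`
induce those of `G̃` (`contMDiff_rho`, `AffineDiscreteConnection.contMDiff_Lhat`). The theorem
follows by the chain rule from a description of `𝒟`.

* Since `ker T_q π` consists of infinitesimal generators (`exists_infGen_eq`) and `𝒟 = 𝒮 ⊕ H` with
  `H` horizontal, `𝒟_q` consists exactly of the vectors `h^q(u) + ξ_Q(q)` with `u ∈ 𝒟̂_{π(q)}` and
  `ξ ∈ 𝔤^𝒟_q` (`NonholonomicConnection.horLift_mem`, `NonholonomicConnection.exists_gD_of_mem`).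
* The principle and the equations on `Q` are equivalent by a rearrangement of the sum for `dS_d`
  and by testing with variations supported at one index (`principle_iff_equations`).
* Writing `δq_k = h^{q_k}(δτ_k) + (ξ_k)_Q(q_k)`, the chain rule for `L̂_d` turns `dS_d(δq)` into
  `dŜ_d(δv, δτ)` with precisely the admissible reduced variations
  (`principle_iff_reduced_principle`).
* On horizontal lifts the covector `D₁L_d + D₂L_d` is `φ`, by the chain rule for `Ľ_d` (`phi_eq`).
  On infinitesimal generators it is `ψ` (`psi_eq`), because `𝒜_d(q₀, g • q₁) = g 𝒜_d(q₀, q₁)` and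
  `L_d` is invariant under the diagonal action.
* The kinematic constraints correspond because `Φ` is injective (`reduced_mem_reducedDd_iff`).
-/

namespace DiscreteReduction

/-! ### Smoothness of the maps entering the reduction -/

section Smoothness

variable {E EG EB G Q : Type*}
  [NormedAddCommGroup E] [NormedSpace ℝ E] [NormedAddCommGroup EG] [NormedSpace ℝ EG]
  [NormedAddCommGroup EB] [NormedSpace ℝ EB]
  [TopologicalSpace G] [ChartedSpace EG G] [Group G]
  [TopologicalSpace Q] [ChartedSpace E Q] [MulAction G Q]
  [ChartedSpace EB (Shape G Q)] (h : IsPrincipalBundle E EG EB G Q)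

theorem triv_contMDiffAt {b : Shape G Q} {q : Q} (hq : proj G Q q ∈ (triv h b).baseSet) :
    ContMDiffAt 𝓘(ℝ, E) (𝓘(ℝ, EB).prod 𝓘(ℝ, EG)) ∞ (triv h b) q :=
  (triv_contMDiffOn h b).contMDiffAt
    ((triv h b).open_source.mem_nhds ((triv h b).mem_source.2 hq))

theorem contMDiff_proj (h : IsPrincipalBundle E EG EB G Q) :
    ContMDiff 𝓘(ℝ, E) 𝓘(ℝ, EB) ∞ (proj G Q) := by
  intro q
  have hq := mem_triv h (proj G Q q)
  refine (contMDiffAt_fst.comp q (triv_contMDiffAt h hq)).congr_of_eventuallyEq ?_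
  filter_upwards [(triv h (proj G Q q)).open_source.mem_nhds ((triv h _).mem_source.2 hq)]
    with x hx
  exact ((triv h (proj G Q q)).coe_fst hx).symm

theorem sec_contMDiffAt {b x : Shape G Q} (hx : x ∈ (triv h b).baseSet) :
    ContMDiffAt 𝓘(ℝ, EB) 𝓘(ℝ, E) ∞ (sec h b) x := by
  have h1 : ContMDiffAt (𝓘(ℝ, EB).prod 𝓘(ℝ, EG)) 𝓘(ℝ, E) ∞
      (triv h b).toOpenPartialHomeomorph.symm (x, (1 : G)) :=
    (triv_symm_contMDiffOn h b).contMDiffAt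
      ((triv h b).open_target.mem_nhds ((triv h b).mem_target.2 hx))
  exact h1.comp x (f := fun y : Shape G Q => (y, (1 : G)))
    (contMDiffAt_id.prodMk contMDiffAt_const)

namespace AffineDiscreteConnection

variable {h} [IsManifold 𝓘(ℝ, E) ∞ Q] (A : AffineDiscreteConnection h)

theorem lift_unique {q q₁ : Q} (hq : (q, q₁) ∈ A.Hor) : A.lift q (proj G Q q₁) = q₁ :=
  congrArg Prod.snd (A.injOn (A.lift_spec q (proj G Q q₁)).1 hq
    (by simp [(A.lift_spec q (proj G Q q₁)).2]))

/-- `𝒜_d(q₀, q₁)` moves the horizontal lift of `π(q₁)` to `q₁`. -/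
theorem form_smul_lift (q₀ q₁ : Q) : A.form (q₀, q₁) • A.lift q₀ (proj G Q q₁) = q₁ := by
  have := A.lift_unique (A.form_spec q₀ q₁)
  rw [proj_smul] at this
  rw [this, smul_inv_smul]

theorem form_eq_of_smul_lift {q₀ q₁ : Q} {g : G} (hg : g • A.lift q₀ (proj G Q q₁) = q₁) :
    A.form (q₀, q₁) = g := by
  refine A.form_unique (A.form_spec q₀ q₁) ?_
  have := (A.lift_spec q₀ (proj G Q q₁)).1
  rwa [← inv_smul_eq_iff.2 hg.symm] at this

/-- Left translation of the second argument multiplies the discrete connection form. -/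
theorem form_smul_right (g : G) (q₀ q₁ : Q) : A.form (q₀, g • q₁) = g * A.form (q₀, q₁) := by
  apply A.form_eq_of_smul_lift
  rw [proj_smul, mul_smul, form_smul_lift]

/-- The horizontal lift is smooth: locally it is the second component of a smooth local inverse of
`(id × π)|_Hor`, because that restriction is injective. -/
theorem contMDiff_lift : ContMDiff (𝓘(ℝ, E).prod 𝓘(ℝ, EB)) 𝓘(ℝ, E) ∞
    (fun p : Q × Shape G Q => A.lift p.1 p.2) := by
  rintro ⟨q, τ⟩
  obtain ⟨V, hV, hmem, σ, hσ, hσ'⟩ := A.local_inverse _ (A.lift_spec q τ).1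
  rw [(A.lift_spec q τ).2] at hmem
  refine ((hσ.contMDiffAt (hV.mem_nhds hmem)).snd).congr_of_eventuallyEq ?_
  filter_upwards [hV.mem_nhds hmem] with x hx
  obtain ⟨h1, h2⟩ := hσ' x hx
  have h3 : (σ x).1 = x.1 := congrArg Prod.fst h2
  have h4 : proj G Q (σ x).2 = x.2 := congrArg Prod.snd h2
  rw [← h3, ← h4]
  exact A.lift_unique h1

variable [LieGroup 𝓘(ℝ, EG) ∞ G]

/-- The form `𝒜_d` is smooth: by equivariance it is the quotient of the group coordinates of `q₁`
and of the horizontal lift of `π(q₁)` in a trivialization around `π(q₁)`. -/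
theorem contMDiff_form : ContMDiff (𝓘(ℝ, E).prod 𝓘(ℝ, E)) 𝓘(ℝ, EG) ∞ A.form := by
  rintro ⟨q₀, q₁⟩
  set b := proj G Q q₁ with hb
  have hπ : ContMDiff (𝓘(ℝ, E).prod 𝓘(ℝ, E)) 𝓘(ℝ, EB) ∞ (fun p : Q × Q => proj G Q p.2) :=
    (contMDiff_proj h).comp contMDiff_snd
  have hl : ContMDiff (𝓘(ℝ, E).prod 𝓘(ℝ, E)) 𝓘(ℝ, E) ∞
      (fun p : Q × Q => A.lift p.1 (proj G Q p.2)) :=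
    A.contMDiff_lift.comp (contMDiff_fst.prodMk hπ)
  have h1 : ContMDiffAt (𝓘(ℝ, E).prod 𝓘(ℝ, E)) 𝓘(ℝ, EG) ∞
      (fun p : Q × Q => (triv h b p.2).2) (q₀, q₁) :=
    ((triv_contMDiffAt h (mem_triv h b)).comp (q₀, q₁) contMDiffAt_snd).snd
  have h2 : ContMDiffAt (𝓘(ℝ, E).prod 𝓘(ℝ, E)) 𝓘(ℝ, EG) ∞
      (fun p : Q × Q => (triv h b (A.lift p.1 (proj G Q p.2))).2) (q₀, q₁) := by
    refine ContMDiffAt.snd (ContMDiffAt.comp (q₀, q₁) (g := triv h b)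
      (f := fun p : Q × Q => A.lift p.1 (proj G Q p.2)) (triv_contMDiffAt h ?_) (hl (q₀, q₁)))
    rw [(A.lift_spec _ _).2]
    exact mem_triv h b
  refine (h1.mul h2.inv).congr_of_eventuallyEq ?_
  filter_upwards [((triv h b).open_baseSet.preimage hπ.continuous).mem_nhds (mem_triv h b)]
    with p hp
  have hp' : proj G Q (A.lift p.1 (proj G Q p.2)) ∈ (triv h b).baseSet := by
    rwa [(A.lift_spec _ _).2]
  have key := triv_smul h b (A.form p) hp'
  rw [A.form_smul_lift p.1 p.2] at key
  exact eq_mul_inv_of_mul_eq key.symm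

theorem contMDiff_Lcheck (S : NonholonomicDMS E Q) :
    ContMDiff (𝓘(ℝ, E).prod (𝓘(ℝ, EG).prod 𝓘(ℝ, EB))) 𝓘(ℝ, ℝ) ∞ (A.Lcheck S) := by
  have hl : ContMDiff (𝓘(ℝ, E).prod (𝓘(ℝ, EG).prod 𝓘(ℝ, EB))) 𝓘(ℝ, E) ∞
      (fun x : Q × G × Shape G Q => A.lift x.1 x.2.2) :=
    A.contMDiff_lift.comp (contMDiff_fst.prodMk (contMDiff_snd.comp contMDiff_snd))
  have hF : ContMDiff (𝓘(ℝ, E).prod (𝓘(ℝ, EG).prod 𝓘(ℝ, EB))) 𝓘(ℝ, E) ∞ A.F₁ :=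
    h.contMDiff_smul.comp ((contMDiff_fst.comp contMDiff_snd).prodMk hl)
  exact S.contMDiff_L.comp (contMDiff_fst.prodMk hF)

end AffineDiscreteConnection

variable [LieGroup 𝓘(ℝ, EG) ∞ G]

/-- The trivialization of `G̃` around the base point of `v` is smooth at `v`, since the preferred
chart at `v` is that trivialization followed by a chart of `Q/G × G`. -/
theorem conjTriv_contMDiffAt [IsManifold 𝓘(ℝ, EB) ∞ (Shape G Q)] (v : ConjBundle h) :
    ContMDiffAt (𝓘(ℝ, EB).prod 𝓘(ℝ, EG)) (𝓘(ℝ, EB).prod 𝓘(ℝ, EG)) ∞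
      (conjTriv h (ConjBundle.pr h v)) v := by
  set b := ConjBundle.pr h v with hb
  set x := conjTriv h b v with hx
  have hx1 : x.1 = b := by
    obtain ⟨p, rfl⟩ := exists_rho h v
    rfl
  have hc : chartAt (ModelProd EB EG) v
      = (conjTriv h b).trans (chartAt (ModelProd EB EG) x) := by
    change (conjTriv h x.1).trans _ = _
    rw [hx1]
  have h1 : ContMDiffAt (𝓘(ℝ, EB).prod 𝓘(ℝ, EG)) (𝓘(ℝ, EB).prod 𝓘(ℝ, EG)) ∞
      (chartAt (ModelProd EB EG) v) v :=
    contMDiffAt_of_mem_maximalAtlas (IsManifold.chart_mem_maximalAtlas v)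
      (mem_chart_source _ v)
  have hv : chartAt (ModelProd EB EG) v v = chartAt (ModelProd EB EG) x x := by rw [hc]; rfl
  have h2 : ContMDiffAt (𝓘(ℝ, EB).prod 𝓘(ℝ, EG)) (𝓘(ℝ, EB).prod 𝓘(ℝ, EG)) ∞
      (chartAt (ModelProd EB EG) x).symm (chartAt (ModelProd EB EG) v v) := by
    rw [hv]
    exact contMDiffAt_symm_of_mem_maximalAtlas (IsManifold.chart_mem_maximalAtlas x)
      (mem_chart_target _ x)
  refine (h2.comp v h1).congr_of_eventuallyEq ?_
  filter_upwards [(chartAt (ModelProd EB EG) v).open_source.mem_nhds (mem_chart_source _ v)]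
    with u hu
  rw [hc] at hu
  simp only [Function.comp, hc]
  exact ((chartAt (ModelProd EB EG) x).left_inv hu.2).symm

/-- The quotient map `ρ` is smooth: in the trivialization of `G̃` around a point of its image it is
`(q, w) ↦ (π(q), c(q)⁻¹ w c(q))`, where `c` is the group coordinate of `π`. -/
theorem contMDiff_rho [IsManifold 𝓘(ℝ, EB) ∞ (Shape G Q)] :
    ContMDiff (𝓘(ℝ, E).prod 𝓘(ℝ, EG)) (𝓘(ℝ, EB).prod 𝓘(ℝ, EG)) ∞ (rho h) := by
  intro p
  set b := proj G Q p.1 with hb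
  set x := conjTriv h b (rho h p) with hx
  have hc : chartAt (ModelProd EB EG) (rho h p)
      = (conjTriv h b).trans (chartAt (ModelProd EB EG) x) := rfl
  have hπ : ContMDiff (𝓘(ℝ, E).prod 𝓘(ℝ, EG)) 𝓘(ℝ, EB) ∞ (fun p : Q × G => proj G Q p.1) :=
    (contMDiff_proj h).comp contMDiff_fst
  have h1 : ContMDiffAt (𝓘(ℝ, E).prod 𝓘(ℝ, EG)) 𝓘(ℝ, EG) ∞
      (fun p : Q × G => (triv h b p.1).2) p :=
    ((triv_contMDiffAt h (mem_triv h b)).comp p contMDiffAt_fst).snd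
  have hnear : ∀ᶠ p' in 𝓝 p, proj G Q p'.1 ∈ (triv h b).baseSet :=
    ((triv h b).open_baseSet.preimage hπ.continuous).mem_nhds (mem_triv h b)
  have h2 : ContMDiffAt (𝓘(ℝ, E).prod 𝓘(ℝ, EG)) (𝓘(ℝ, EB).prod 𝓘(ℝ, EG)) ∞
      (fun p' => conjTriv h b (rho h p')) p := by
    refine ((hπ p).prodMk ((h1.inv.mul contMDiffAt_snd).mul h1)).congr_of_eventuallyEq ?_
    filter_upwards [hnear] with p' hp'
    exact conjTrivFun_rho h b hp'
  have h3 : ContMDiffAt (𝓘(ℝ, EB).prod 𝓘(ℝ, EG)) (𝓘(ℝ, EB).prod 𝓘(ℝ, EG)) ∞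
      (chartAt (ModelProd EB EG) x) x :=
    contMDiffAt_of_mem_maximalAtlas (IsManifold.chart_mem_maximalAtlas x)
      (mem_chart_source _ x)
  have h4 : ContMDiffAt (𝓘(ℝ, EB).prod 𝓘(ℝ, EG)) (𝓘(ℝ, EB).prod 𝓘(ℝ, EG)) ∞
      (chartAt (ModelProd EB EG) (rho h p)).symm (chartAt (ModelProd EB EG) x x) :=
    contMDiffAt_symm_of_mem_maximalAtlas (IsManifold.chart_mem_maximalAtlas (rho h p))
      (mem_chart_target _ (rho h p))
  refine (h4.comp p (h3.comp p h2)).congr_of_eventuallyEq ?_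
  have hs : ∀ᶠ p' in 𝓝 p, rho h p' ∈ (chartAt (ModelProd EB EG) (rho h p)).source :=
    (isQuotientMap_rho h).continuous.continuousAt.eventually
      ((chartAt (ModelProd EB EG) (rho h p)).open_source.mem_nhds (mem_chart_source _ _))
  filter_upwards [hs] with p' hp'
  exact ((chartAt (ModelProd EB EG) (rho h p)).left_inv hp').symm

/-- The reduced Lagrangian is smooth, since it is `Ľ_d` composed with a local section of `ρ`. -/
theorem AffineDiscreteConnection.contMDiff_Lhat [IsManifold 𝓘(ℝ, E) ∞ Q]
    [IsManifold 𝓘(ℝ, EB) ∞ (Shape G Q)] {h : IsPrincipalBundle E EG EB G Q}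
    (A : AffineDiscreteConnection h) (S : NonholonomicDMS E Q) (hS : IsSymmetryGroup G S) :
    ContMDiff ((𝓘(ℝ, EB).prod 𝓘(ℝ, EG)).prod 𝓘(ℝ, EB)) 𝓘(ℝ, ℝ) ∞ (A.Lhat S hS) := by
  rintro ⟨v, τ⟩
  set b := ConjBundle.pr h v with hb
  have hv : v ∈ (conjTriv h b).source := mem_triv h b
  have h1 : ContMDiffAt ((𝓘(ℝ, EB).prod 𝓘(ℝ, EG)).prod 𝓘(ℝ, EB)) (𝓘(ℝ, EB).prod 𝓘(ℝ, EG)) ∞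
      (fun x : ConjBundle h × Shape G Q => conjTriv h b x.1) (v, τ) :=
    (conjTriv_contMDiffAt h v).comp (v, τ) contMDiffAt_fst
  have h2 : ContMDiffAt ((𝓘(ℝ, EB).prod 𝓘(ℝ, EG)).prod 𝓘(ℝ, EB)) 𝓘(ℝ, E) ∞
      (fun x : ConjBundle h × Shape G Q => sec h b (conjTriv h b x.1).1) (v, τ) :=
    ContMDiffAt.comp (v, τ) (g := sec h b) (f := fun x => (conjTriv h b x.1).1)
      (sec_contMDiffAt h ((conjTriv h b).map_source hv).1) h1.fst
  refine ((A.contMDiff_Lcheck S).contMDiffAt.comp (v, τ)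
    (h2.prodMk (h1.snd.prodMk contMDiffAt_snd))).congr_of_eventuallyEq ?_
  have hs : ∀ᶠ x : ConjBundle h × Shape G Q in 𝓝 (v, τ), x.1 ∈ (conjTriv h b).source :=
    continuousAt_fst.eventually ((conjTriv h b).open_source.mem_nhds hv)
  filter_upwards [hs] with x hx
  have := (conjTriv h b).left_inv hx
  exact congrArg (fun u => A.Lhat S hS (u, x.2)) this.symm

end Smoothness

/-! ### Tangent vectors of the principal bundle -/

section Derivatives

variable {E₁ H₁ M₁ E₂ H₂ M₂ E₃ H₃ M₃ : Type*}
  [NormedAddCommGroup E₁] [NormedSpace ℝ E₁] [TopologicalSpace H₁]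
  [TopologicalSpace M₁] [ChartedSpace H₁ M₁]
  [NormedAddCommGroup E₂] [NormedSpace ℝ E₂] [TopologicalSpace H₂]
  [TopologicalSpace M₂] [ChartedSpace H₂ M₂]
  [NormedAddCommGroup E₃] [NormedSpace ℝ E₃] [TopologicalSpace H₃]
  [TopologicalSpace M₃] [ChartedSpace H₃ M₃]
  {I₁ : ModelWithCorners ℝ E₁ H₁} {I₂ : ModelWithCorners ℝ E₂ H₂} {I₃ : ModelWithCorners ℝ E₃ H₃}

theorem map_prodMk_eq_add (f : E₁ × E₂ →L[ℝ] E₃) (a : E₁) (b : E₂) :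
    f (a, b) = f (a, 0) + f (0, b) := by
  rw [← map_add, Prod.mk_add_mk, add_zero, zero_add]

theorem pairT_eq {x : M₁} {y : M₂} (v : TangentSpace I₁ x) (w : TangentSpace I₂ y) :
    pairT I₁ I₂ v w = ((v, w) : E₁ × E₂) :=
  Prod.ext (add_zero (M := E₁) v) (zero_add (M := E₂) w)

theorem pairT_add {x : M₁} {y : M₂} (v v' : TangentSpace I₁ x) (w w' : TangentSpace I₂ y) :
    pairT I₁ I₂ (v + v') (w + w') = pairT I₁ I₂ v w + pairT I₁ I₂ v' w' := by
  simp only [pairT, map_add]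
  exact add_add_add_comm _ _ _ _

/-- The chain rule with derivatives regarded as maps of the model vector spaces, so that the base
point `f x` may be replaced by an equal point `y`. -/
theorem hasMFDerivAt_comp_of_eq {f : M₁ → M₂} {g : M₂ → M₃} {x : M₁} {y : M₂}
    {f' : E₁ →L[ℝ] E₂} {g' : E₂ →L[ℝ] E₃} (hg : HasMFDerivAt I₂ I₃ g y g')
    (hf : HasMFDerivAt I₁ I₂ f x f') (hy : f x = y) :
    HasMFDerivAt I₁ I₃ (g ∘ f) x (g'.comp f' : E₁ →L[ℝ] E₃) := by
  subst hy
  exact hg.comp x hf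

/-- The evaluation map of a finite power of a manifold has the evaluation map of the model vector
space as its derivative. -/
theorem hasMFDerivAt_pi_apply {ι : Type*} [Fintype ι] (x : ι → M₁) (i : ι) :
    HasMFDerivAt (ModelWithCorners.pi fun _ : ι => I₁) I₁ (fun y : ι → M₁ => y i) x
      (ContinuousLinearMap.proj i : (ι → E₁) →L[ℝ] E₁) := by
  refine ⟨(continuous_apply i).continuousAt, ?_⟩
  have hev : ∀ u ∈ (extChartAt (ModelWithCorners.pi fun _ : ι => I₁) x).target,
      writtenInExtChartAt (ModelWithCorners.pi fun _ : ι => I₁) I₁ x (fun y : ι → M₁ => y i) u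
        = (ContinuousLinearMap.proj i : (ι → E₁) →L[ℝ] E₁) u := fun u hu =>
    congrFun ((extChartAt (ModelWithCorners.pi fun _ : ι => I₁) x).right_inv hu) i
  refine HasFDerivWithinAt.congr_of_eventuallyEq
    (ContinuousLinearMap.proj i : (ι → E₁) →L[ℝ] E₁).hasFDerivWithinAt ?_
    (hev _ (mem_extChartAt_target x))
  filter_upwards [extChartAt_target_mem_nhdsWithin (I := ModelWithCorners.pi fun _ : ι => I₁) x]
    using hev

end Derivatives

section Tangent

variable {E EG EB G Q : Type*}
  [NormedAddCommGroup E] [NormedSpace ℝ E] [NormedAddCommGroup EG] [NormedSpace ℝ EG]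
  [NormedAddCommGroup EB] [NormedSpace ℝ EB]
  [TopologicalSpace G] [ChartedSpace EG G] [Group G] [LieGroup 𝓘(ℝ, EG) ∞ G]
  [TopologicalSpace Q] [ChartedSpace E Q] [IsManifold 𝓘(ℝ, E) ∞ Q] [MulAction G Q]
  [ChartedSpace EB (Shape G Q)] (h : IsPrincipalBundle E EG EB G Q)

theorem mdifferentiableAt_proj (h : IsPrincipalBundle E EG EB G Q) (q : Q) :
    MDifferentiableAt 𝓘(ℝ, E) 𝓘(ℝ, EB) (proj G Q) q :=
  (contMDiff_proj h q).mdifferentiableAt (by simp)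

theorem contMDiff_orbitMap (h : IsPrincipalBundle E EG EB G Q) (q : Q) :
    ContMDiff 𝓘(ℝ, EG) 𝓘(ℝ, E) ∞ (fun g : G => g • q) :=
  h.contMDiff_smul.comp (contMDiff_id.prodMk contMDiff_const)

theorem contMDiff_const_smul (h : IsPrincipalBundle E EG EB G Q) (g : G) :
    ContMDiff 𝓘(ℝ, E) 𝓘(ℝ, E) ∞ (fun q : Q => g • q) :=
  h.contMDiff_smul.comp (contMDiff_const.prodMk contMDiff_id)

theorem mdifferentiableAt_orbitMap (h : IsPrincipalBundle E EG EB G Q) (q : Q) (g : G) :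
    MDifferentiableAt 𝓘(ℝ, EG) 𝓘(ℝ, E) (fun g : G => g • q) g :=
  (contMDiff_orbitMap h q g).mdifferentiableAt (by simp)

theorem hasMFDerivAt_orbitMap (q : Q) :
    HasMFDerivAt 𝓘(ℝ, EG) 𝓘(ℝ, E) (fun g : G => g • q) 1 (infGen h q : EG →L[ℝ] E) :=
  (mdifferentiableAt_orbitMap h q 1).hasMFDerivAt

/-- Infinitesimal generators are vertical. -/
theorem tangentProj_infGen (q : Q) (ξ : GroupLieAlgebra 𝓘(ℝ, EG) G) :
    tangentProj h q (infGen h q ξ) = 0 := by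
  have h1 := hasMFDerivAt_comp_of_eq (mdifferentiableAt_proj h q).hasMFDerivAt
    (hasMFDerivAt_orbitMap h q) (one_smul G q)
  have h2 : proj G Q ∘ (fun g : G => g • q) = fun _ => proj G Q q := by
    funext g
    exact proj_smul g q
  rw [h2] at h1
  exact DFunLike.congr_fun (hasMFDerivAt_unique h1 (hasMFDerivAt_const _ _)) ξ

/-- A vertical vector is an infinitesimal generator: in a trivialization with section `s` one has
`x = (e x).2 • s(π x)`, and along a vertical vector only the first factor varies. -/
theorem exists_infGen_eq {q : Q} {v : TangentSpace 𝓘(ℝ, E) q} (hv : v ∈ vertical h q) :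
    ∃ ξ : GroupLieAlgebra 𝓘(ℝ, EG) G, infGen h q ξ = v := by
  set b := proj G Q q with hb
  have hmem := mem_triv h b
  set g₀ := (triv h b q).2 with hg₀
  -- near `q`, `c x` is the group element with `x = c x • g₀ • s(π x)`, so that `c q = 1`
  let c : Q → G := fun x => (triv h b x).2 * g₀⁻¹
  have hcq : c q = 1 := mul_inv_cancel _
  have hc : MDifferentiableAt 𝓘(ℝ, E) 𝓘(ℝ, EG) c q :=
    (((triv_contMDiffAt h hmem).snd).mul contMDiffAt_const).mdifferentiableAt (by simp)
  let s : Shape G Q → Q := fun x => g₀ • sec h b x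
  have hsb : s b = q := smul_sec h b hmem
  have hs : MDifferentiableAt 𝓘(ℝ, EB) 𝓘(ℝ, E) s b :=
    ((contMDiff_const_smul h g₀).contMDiffAt.comp b
      (sec_contMDiffAt h hmem)).mdifferentiableAt (by simp)
  have hsπ := hs.hasMFDerivAt.comp q (mdifferentiableAt_proj h q).hasMFDerivAt
  have hsm : MDifferentiableAt (𝓘(ℝ, EG).prod 𝓘(ℝ, E)) 𝓘(ℝ, E) (fun p : G × Q => p.1 • p.2)
      ((1 : G), q) := (h.contMDiff_smul _).mdifferentiableAt (by simp)
  have hpair := hc.hasMFDerivAt.prodMk hsπ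
  have hcomp := hasMFDerivAt_comp_of_eq hsm.hasMFDerivAt hpair (Prod.ext hcq hsb)
  have hid : (fun p : G × Q => p.1 • p.2) ∘ (fun x => (c x, (s ∘ proj G Q) x)) =ᶠ[𝓝 q] id := by
    filter_upwards [(triv h b).open_source.mem_nhds ((triv h b).mem_source.2 hmem)] with x hx
    simp only [Function.comp, c, s, id, smul_smul, inv_mul_cancel_right]
    exact smul_sec h b ((triv h b).mem_source.1 hx)
  have horb := hasMFDerivAt_comp_of_eq hsm.hasMFDerivAt
    ((hasMFDerivAt_id (I := 𝓘(ℝ, EG)) (1 : G)).prodMk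
      (hasMFDerivAt_const (I := 𝓘(ℝ, EG)) (I' := 𝓘(ℝ, E)) q (1 : G))) rfl
  have e1 := DFunLike.congr_fun
    (hasMFDerivAt_unique (hcomp.congr_of_eventuallyEq hid.symm) (hasMFDerivAt_id q)) v
  refine ⟨mfderiv 𝓘(ℝ, E) 𝓘(ℝ, EG) c q v, ?_⟩
  have e2 := DFunLike.congr_fun (hasMFDerivAt_unique (hasMFDerivAt_orbitMap h q) horb)
    (mfderiv 𝓘(ℝ, E) 𝓘(ℝ, EG) c q v)
  refine e2.trans (Eq.trans ?_ e1)
  have hv' : mfderiv 𝓘(ℝ, E) 𝓘(ℝ, EB) (proj G Q) q v = 0 := hv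
  have hv'' : (mfderiv 𝓘(ℝ, EB) 𝓘(ℝ, E) s b).comp (mfderiv 𝓘(ℝ, E) 𝓘(ℝ, EB) (proj G Q) q) v
      = 0 := by
    rw [ContinuousLinearMap.comp_apply, hv', map_zero]
  exact congrArg (fun u : E => mfderiv (𝓘(ℝ, EG).prod 𝓘(ℝ, E)) 𝓘(ℝ, E)
    (fun p : G × Q => p.1 • p.2) ((1 : G), q) (mfderiv 𝓘(ℝ, E) 𝓘(ℝ, EG) c q v, u)) hv''.symm

/-- `T_q π` is surjective, because there is a local section through `q`. -/
theorem surjective_tangentProj (q : Q) : Function.Surjective (tangentProj h q) := by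
  set b := proj G Q q with hb
  have hmem := mem_triv h b
  set g₀ := (triv h b q).2 with hg₀
  intro u
  let s : Shape G Q → Q := fun x => g₀ • sec h b x
  have hsb : s b = q := smul_sec h b hmem
  have hs : MDifferentiableAt 𝓘(ℝ, EB) 𝓘(ℝ, E) s b :=
    ((contMDiff_const_smul h g₀).contMDiffAt.comp b
      (sec_contMDiffAt h hmem)).mdifferentiableAt (by simp)
  have hcomp := hasMFDerivAt_comp_of_eq (mdifferentiableAt_proj h q).hasMFDerivAt
    hs.hasMFDerivAt hsb
  have hid : proj G Q ∘ s =ᶠ[𝓝 b] id := by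
    filter_upwards [(triv h b).open_baseSet.mem_nhds hmem] with x hx
    simp only [Function.comp, s, id, proj_smul, proj_sec h b hx]
  exact ⟨mfderiv 𝓘(ℝ, EB) 𝓘(ℝ, E) s b u, DFunLike.congr_fun
    (hasMFDerivAt_unique (hcomp.congr_of_eventuallyEq hid.symm) (hasMFDerivAt_id b)) u⟩

end Tangent

/-! ### The horizontal lift -/

section HorizontalLift

variable {E EG EB G Q : Type*}
  [NormedAddCommGroup E] [NormedSpace ℝ E] [FiniteDimensional ℝ E]
  [NormedAddCommGroup EG] [NormedSpace ℝ EG]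
  [NormedAddCommGroup EB] [NormedSpace ℝ EB] [FiniteDimensional ℝ EB]
  [TopologicalSpace G] [ChartedSpace EG G] [Group G] [LieGroup 𝓘(ℝ, EG) ∞ G]
  [TopologicalSpace Q] [ChartedSpace E Q] [IsManifold 𝓘(ℝ, E) ∞ Q] [MulAction G Q]
  [ChartedSpace EB (Shape G Q)] {h : IsPrincipalBundle E EG EB G Q} {S : NonholonomicDMS E Q}

namespace NonholonomicConnection

variable (C : NonholonomicConnection h S)

/-- Horizontal and vertical space are complementary: they are sums over complementary sets of
indices in the decomposition `W ⊕ U ⊕ 𝒮 ⊕ H`. -/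
theorem isCompl_horizontal_vertical (q : Q) : IsCompl (C.horizontal q) (vertical h q) := by
  have hint := (DirectSum.isInternal_submodule_iff_iSupIndep_and_iSup_eq_top _).1 (C.isInternal q)
  have hV : vertical h q = ⨆ i ∈ ({1, 2} : Set (Fin 4)),
      ![C.W q, C.U q, vertical h q ⊓ S.D q, C.H q] i := by
    rw [iSup_pair]
    exact (C.vertical_eq q).trans (sup_comm _ _)
  have hH : C.horizontal q = ⨆ i ∈ ({0, 3} : Set (Fin 4)),
      ![C.W q, C.U q, vertical h q ⊓ S.D q, C.H q] i := by
    rw [iSup_pair]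
    rfl
  constructor
  · rw [hV, hH]
    refine hint.1.disjoint_biSup_biSup ?_
    simp
  · rw [hV, hH, codisjoint_iff, ← iSup_union, ← hint.2]
    refine iSup_congr fun i => ?_
    fin_cases i <;> simp

theorem isInvertible_tangentProj_horizontal (q : Q) :
    ((tangentProj h q).comp (C.horizontal q).subtypeL).IsInvertible := by
  have hcompl := C.isCompl_horizontal_vertical q
  have hinj : Function.Injective ((tangentProj h q).comp (C.horizontal q).subtypeL) := by
    rw [injective_iff_map_eq_zero]
    intro v hv
    have hv0 : (v : TangentSpace 𝓘(ℝ, E) q) ∈ C.horizontal q ⊓ vertical h q := ⟨v.2, hv⟩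
    rw [hcompl.inf_eq_bot] at hv0
    exact Subtype.ext hv0
  have hsurj : Function.Surjective ((tangentProj h q).comp (C.horizontal q).subtypeL) := by
    intro u
    obtain ⟨v, rfl⟩ := surjective_tangentProj h q u
    have hv : v ∈ C.horizontal q ⊔ vertical h q := by
      rw [hcompl.sup_eq_top]
      trivial
    obtain ⟨x, hx, y, hy, rfl⟩ := Submodule.mem_sup.1 hv
    refine ⟨⟨x, hx⟩, ?_⟩
    have hy' : tangentProj h q y = 0 := hy
    rw [map_add, hy', add_zero]
    rfl
  have : FiniteDimensional ℝ (TangentSpace 𝓘(ℝ, E) q) := inferInstanceAs (FiniteDimensional ℝ E)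
  have : T2Space (TangentSpace 𝓘(ℝ, E) q) := inferInstanceAs (T2Space E)
  have : T2Space (TangentSpace 𝓘(ℝ, EB) (proj G Q q)) := inferInstanceAs (T2Space EB)
  exact ⟨(LinearEquiv.ofBijective
    ((tangentProj h q).comp (C.horizontal q).subtypeL).toLinearMap
    ⟨hinj, hsurj⟩).toContinuousLinearEquiv, rfl⟩

theorem tangentProj_horLift (q : Q) (u : TangentSpace 𝓘(ℝ, EB) (proj G Q q)) :
    tangentProj h q (C.horLift q u) = u :=
  (C.isInvertible_tangentProj_horizontal q).self_apply_inverse u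

theorem horLift_tangentProj {q : Q} {v : TangentSpace 𝓘(ℝ, E) q} (hv : v ∈ C.horizontal q) :
    C.horLift q (tangentProj h q v) = v :=
  congrArg Subtype.val ((C.isInvertible_tangentProj_horizontal q).inverse_apply_self ⟨v, hv⟩)

/-- The horizontal lift of a vector of `𝒟̂` lies in `𝒟`: such a vector is `T π v` with `v` in the
summand `H` of `𝒟 = 𝒮 ⊕ H`, and then `v` is its horizontal lift. -/
theorem horLift_mem {q : Q} {u : TangentSpace 𝓘(ℝ, EB) (proj G Q q)} (hu : u ∈ reducedD h S q) :
    C.horLift q u ∈ S.D q := by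
  obtain ⟨v, hv, rfl⟩ := hu
  have hv' : v ∈ (vertical h q ⊓ S.D q) ⊔ C.H q := by
    rw [← C.D_eq q]
    exact hv
  obtain ⟨x, hx, y, hy, rfl⟩ := Submodule.mem_sup.1 hv'
  have hx' : tangentProj h q x = 0 := hx.1
  change C.horLift q (tangentProj h q (x + y)) ∈ S.D q
  rw [map_add, hx', zero_add, C.horLift_tangentProj (Submodule.mem_sup_right hy), C.D_eq q]
  exact Submodule.mem_sup_right hy

/-- Every vector of `𝒟_q` is the sum of a horizontal lift and an infinitesimal generator of an
element of `𝔤^𝒟_q`: its vertical part lies in `𝒟_q` because its horizontal part does. -/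
theorem exists_gD_of_mem {q : Q} {v : TangentSpace 𝓘(ℝ, E) q} (hv : v ∈ S.D q) :
    ∃ ξ ∈ gD h S q, C.horLift q (tangentProj h q v) + infGen h q ξ = v := by
  have hmem : C.horLift q (tangentProj h q v) ∈ S.D q := C.horLift_mem ⟨v, hv, rfl⟩
  obtain ⟨ξ, hξ⟩ := exists_infGen_eq h (q := q) (v := v - C.horLift q (tangentProj h q v)) (by
    change tangentProj h q _ = 0
    rw [map_sub, C.tangentProj_horLift, sub_self])
  refine ⟨ξ, ?_, ?_⟩
  · change infGen h q ξ ∈ S.D q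
    rw [hξ]
    exact Submodule.sub_mem _ hv hmem
  · rw [hξ, add_sub_cancel]

end NonholonomicConnection

end HorizontalLift

/-! ### The differentials of the three Lagrangians -/

section Differentials

variable {E EG EB G Q : Type*}
  [NormedAddCommGroup E] [NormedSpace ℝ E] [NormedAddCommGroup EG] [NormedSpace ℝ EG]
  [NormedAddCommGroup EB] [NormedSpace ℝ EB]
  [TopologicalSpace G] [ChartedSpace EG G] [Group G] [LieGroup 𝓘(ℝ, EG) ∞ G]
  [TopologicalSpace Q] [ChartedSpace E Q] [IsManifold 𝓘(ℝ, E) ∞ Q] [MulAction G Q]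
  [ChartedSpace EB (Shape G Q)] {h : IsPrincipalBundle E EG EB G Q} {S : NonholonomicDMS E Q}

/-- The differential of `L_d` at `(q₀, q₁)`, as a map of the model vector spaces. -/
noncomputable def dL (S : NonholonomicDMS E Q) (q₀ q₁ : Q) : E × E →L[ℝ] ℝ :=
  mfderiv (𝓘(ℝ, E).prod 𝓘(ℝ, E)) 𝓘(ℝ, ℝ) S.L (q₀, q₁)

theorem hasMFDerivAt_L (S : NonholonomicDMS E Q) (q₀ q₁ : Q) :
    HasMFDerivAt (𝓘(ℝ, E).prod 𝓘(ℝ, E)) 𝓘(ℝ, ℝ) S.L (q₀, q₁) (dL S q₀ q₁) :=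
  ((S.contMDiff_L _).mdifferentiableAt (by simp)).hasMFDerivAt

theorem dL_apply (S : NonholonomicDMS E Q) (q₀ q₁ : Q) (v₀ : TangentSpace 𝓘(ℝ, E) q₀)
    (v₁ : TangentSpace 𝓘(ℝ, E) q₁) : dL S q₀ q₁ (v₀, v₁) = S.D₁L q₀ q₁ v₀ + S.D₂L q₀ q₁ v₁ :=
  map_prodMk_eq_add (dL S q₀ q₁) v₀ v₁

theorem hasMFDerivAt_proj_snd (h : IsPrincipalBundle E EG EB G Q) (q₀ q₁ : Q) :
    HasMFDerivAt (𝓘(ℝ, E).prod 𝓘(ℝ, E)) 𝓘(ℝ, EB) (fun p : Q × Q => proj G Q p.2) (q₀, q₁)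
      ((tangentProj h q₁ : E →L[ℝ] EB).comp (ContinuousLinearMap.snd ℝ E E)) :=
  HasMFDerivAt.comp (q₀, q₁) (mdifferentiableAt_proj h q₁).hasMFDerivAt (hasMFDerivAt_snd (q₀, q₁))

namespace AffineDiscreteConnection

variable (A : AffineDiscreteConnection h)

theorem hasMFDerivAt_form (q₀ q₁ : Q) :
    HasMFDerivAt (𝓘(ℝ, E).prod 𝓘(ℝ, E)) 𝓘(ℝ, EG) A.form (q₀, q₁)
      (A.tangentForm q₀ q₁ : E × E →L[ℝ] EG) :=
  ((A.contMDiff_form _).mdifferentiableAt (by simp)).hasMFDerivAt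

theorem Lcheck_form (q₀ q₁ : Q) :
    A.Lcheck S (q₀, A.form (q₀, q₁), proj G Q q₁) = S.L (q₀, q₁) := by
  simp only [Lcheck, F₁, form_smul_lift]

/-- The differential of `Ľ_d`, as a map of the model vector spaces. -/
noncomputable def dLcheck (S : NonholonomicDMS E Q) (q : Q) (w : G) (τ : Shape G Q) :
    E × EG × EB →L[ℝ] ℝ :=
  mfderiv (𝓘(ℝ, E).prod (𝓘(ℝ, EG).prod 𝓘(ℝ, EB))) 𝓘(ℝ, ℝ) (A.Lcheck S) (q, w, τ)

theorem hasMFDerivAt_Lcheck (S : NonholonomicDMS E Q) (q : Q) (w : G) (τ : Shape G Q) :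
    HasMFDerivAt (𝓘(ℝ, E).prod (𝓘(ℝ, EG).prod 𝓘(ℝ, EB))) 𝓘(ℝ, ℝ) (A.Lcheck S) (q, w, τ)
      (A.dLcheck S q w τ) :=
  ((A.contMDiff_Lcheck S _).mdifferentiableAt (by simp)).hasMFDerivAt

/-- The chain rule for `L_d(q₀, q₁) = Ľ_d(q₀, 𝒜_d(q₀, q₁), π(q₁))`. -/
theorem dL_eq_dLcheck (q₀ q₁ : Q) (v : E × E) :
    dL S q₀ q₁ v = A.dLcheck S q₀ (A.form (q₀, q₁)) (proj G Q q₁)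
      (v.1, (A.tangentForm q₀ q₁ : E × E →L[ℝ] EG) v, (tangentProj h q₁ : E →L[ℝ] EB) v.2) := by
  have h1 := (hasMFDerivAt_fst (I := 𝓘(ℝ, E)) (I' := 𝓘(ℝ, E)) (q₀, q₁)).prodMk
    ((A.hasMFDerivAt_form q₀ q₁).prodMk (hasMFDerivAt_proj_snd h q₀ q₁))
  have h2 := hasMFDerivAt_comp_of_eq
    (A.hasMFDerivAt_Lcheck S q₀ (A.form (q₀, q₁)) (proj G Q q₁)) h1 rfl
  have h3 : A.Lcheck S ∘ (fun p : Q × Q => (p.1, A.form p, proj G Q p.2)) = S.L := by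
    funext p
    exact A.Lcheck_form p.1 p.2
  rw [h3] at h2
  exact DFunLike.congr_fun (hasMFDerivAt_unique (hasMFDerivAt_L S q₀ q₁) h2) v

theorem D₁L_eq (q₀ q₁ : Q) (v : TangentSpace 𝓘(ℝ, E) q₀) :
    S.D₁L q₀ q₁ v = A.D₁Lcheck S q₀ (A.form (q₀, q₁)) (proj G Q q₁) v
      + A.D₂Lcheck S q₀ (A.form (q₀, q₁)) (proj G Q q₁)
        (A.tangentForm q₀ q₁ (inlT 𝓘(ℝ, E) 𝓘(ℝ, E) q₀ q₁ v)) := by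
  refine (A.dL_eq_dLcheck q₀ q₁ (v, 0)).trans ?_
  refine (congrArg (fun u : EB => A.dLcheck S q₀ (A.form (q₀, q₁)) (proj G Q q₁)
    (v, (A.tangentForm q₀ q₁ : E × E →L[ℝ] EG) (v, 0), u))
    (map_zero (tangentProj h q₁ : E →L[ℝ] EB))).trans ?_
  exact map_prodMk_eq_add (A.dLcheck S q₀ (A.form (q₀, q₁)) (proj G Q q₁)) v
    ((A.tangentForm q₀ q₁ : E × E →L[ℝ] EG) (v, 0), 0)

theorem D₂L_eq (q₀ q₁ : Q) (v : TangentSpace 𝓘(ℝ, E) q₁) :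
    S.D₂L q₀ q₁ v = A.D₂Lcheck S q₀ (A.form (q₀, q₁)) (proj G Q q₁)
        (A.tangentForm q₀ q₁ (inrT 𝓘(ℝ, E) 𝓘(ℝ, E) q₀ q₁ v))
      + A.D₃Lcheck S q₀ (A.form (q₀, q₁)) (proj G Q q₁) (tangentProj h q₁ v) := by
  refine (A.dL_eq_dLcheck q₀ q₁ (0, v)).trans ?_
  exact map_prodMk_eq_add ((A.dLcheck S q₀ (A.form (q₀, q₁)) (proj G Q q₁)).comp
    (ContinuousLinearMap.inr ℝ E (EG × EB))) ((A.tangentForm q₀ q₁ : E × E →L[ℝ] EG) (0, v))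
    ((tangentProj h q₁ : E →L[ℝ] EB) v)

/-- Along an infinitesimal generator at `q₁`, `𝒜_d` varies by right translation and `π(q₁)` is
constant, since `𝒜_d(q₀, g • q₁) = g 𝒜_d(q₀, q₁)`. -/
theorem D₂L_infGen (q₀ q₁ : Q) (ξ : GroupLieAlgebra 𝓘(ℝ, EG) G) :
    S.D₂L q₀ q₁ (infGen h q₁ ξ) = A.D₂Lcheck S q₀ (A.form (q₀, q₁)) (proj G Q q₁)
      (rightTranslate (A.form (q₀, q₁)) ξ) := by
  set w := A.form (q₀, q₁) with hw
  have h1 := hasMFDerivAt_comp_of_eq (hasMFDerivAt_L S q₀ q₁)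
    ((hasMFDerivAt_const (I := 𝓘(ℝ, EG)) (I' := 𝓘(ℝ, E)) q₀ (1 : G)).prodMk
      (hasMFDerivAt_orbitMap h q₁)) (by rw [one_smul])
  have hR : HasMFDerivAt 𝓘(ℝ, EG) 𝓘(ℝ, EG) (fun x : G => x * w) 1
      (rightTranslate w : EG →L[ℝ] EG) :=
    ((contMDiff_mul_right (I := 𝓘(ℝ, EG)) (n := ∞) (a := w) 1).mdifferentiableAt
      (by simp)).hasMFDerivAt
  have h2 := hasMFDerivAt_comp_of_eq (A.hasMFDerivAt_Lcheck S q₀ w (proj G Q q₁))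
    ((hasMFDerivAt_const (I := 𝓘(ℝ, EG)) (I' := 𝓘(ℝ, E)) q₀ (1 : G)).prodMk
      (hR.prodMk (hasMFDerivAt_const (I := 𝓘(ℝ, EG)) (I' := 𝓘(ℝ, EB)) (proj G Q q₁) (1 : G))))
    (by rw [one_mul])
  have h3 : S.L ∘ (fun g : G => (q₀, g • q₁))
      = A.Lcheck S ∘ (fun g : G => (q₀, g * w, proj G Q q₁)) := by
    funext g
    have := A.Lcheck_form (S := S) q₀ (g • q₁)
    rw [form_smul_right, proj_smul] at this
    exact this.symm
  rw [h3] at h1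
  exact DFunLike.congr_fun (hasMFDerivAt_unique h1 h2) ξ

end AffineDiscreteConnection

/-- The infinitesimal form of the invariance of `L_d`. -/
theorem IsSymmetryGroup.D₁L_infGen (hS : IsSymmetryGroup G S)
    (h : IsPrincipalBundle E EG EB G Q) (q₀ q₁ : Q) (ξ : GroupLieAlgebra 𝓘(ℝ, EG) G) :
    S.D₁L q₀ q₁ (infGen h q₀ ξ) = -S.D₂L q₀ q₁ (infGen h q₁ ξ) := by
  have h1 := hasMFDerivAt_comp_of_eq (hasMFDerivAt_L S q₀ q₁)
    ((hasMFDerivAt_orbitMap h q₀).prodMk (hasMFDerivAt_orbitMap h q₁)) (by rw [one_smul, one_smul])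
  have h2 : S.L ∘ (fun g : G => (g • q₀, g • q₁)) = fun _ => S.L (q₀, q₁) := by
    funext g
    exact hS.L_smul g q₀ q₁
  rw [h2] at h1
  have h3 := DFunLike.congr_fun (hasMFDerivAt_unique h1 (hasMFDerivAt_const _ _)) ξ
  rw [eq_neg_iff_add_eq_zero, ← dL_apply]
  exact h3

variable (A : AffineDiscreteConnection h)

/-- The covector `φ` is the discrete Lagrange–d'Alembert covector on horizontal lifts. -/
theorem phi_eq [FiniteDimensional ℝ E] [FiniteDimensional ℝ EB] (C : NonholonomicConnection h S)
    (q₀ q₁ q₂ : Q) (u : TangentSpace 𝓘(ℝ, EB) (proj G Q q₁)) :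
    phi A C q₀ q₁ q₂ u = (S.D₁L q₁ q₂ + S.D₂L q₀ q₁) (C.horLift q₁ u) := by
  rw [add_apply, A.D₁L_eq, A.D₂L_eq, C.tangentProj_horLift]
  simp only [phi, forceMinus, forcePlus, add_apply,
    ContinuousLinearMap.comp_apply]
  ring

/-- The covector `ψ` is the discrete Lagrange–d'Alembert covector on infinitesimal generators. -/
theorem psi_eq (hS : IsSymmetryGroup G S) (q₀ q₁ q₂ : Q) (ξ : GroupLieAlgebra 𝓘(ℝ, EG) G) :
    psi S A q₀ q₁ q₂ ξ = (S.D₁L q₁ q₂ + S.D₂L q₀ q₁) (infGen h q₁ ξ) := by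
  rw [add_apply, hS.D₁L_infGen h, A.D₂L_infGen, A.D₂L_infGen]
  simp only [psi, sub_apply, ContinuousLinearMap.comp_apply]
  ring

variable [IsManifold 𝓘(ℝ, EB) ∞ (Shape G Q)]

/-- The differential of `L̂_d`, as a map of the model vector spaces. -/
noncomputable def dLhat (hS : IsSymmetryGroup G S) (x : ConjBundle h × Shape G Q) :
    (EB × EG) × EB →L[ℝ] ℝ :=
  mfderiv ((𝓘(ℝ, EB).prod 𝓘(ℝ, EG)).prod 𝓘(ℝ, EB)) 𝓘(ℝ, ℝ) (A.Lhat S hS) x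

theorem hasMFDerivAt_Lhat (hS : IsSymmetryGroup G S) (x : ConjBundle h × Shape G Q) :
    HasMFDerivAt ((𝓘(ℝ, EB).prod 𝓘(ℝ, EG)).prod 𝓘(ℝ, EB)) 𝓘(ℝ, ℝ) (A.Lhat S hS) x
      (dLhat A hS x) :=
  ((A.contMDiff_Lhat S hS _).mdifferentiableAt (by simp)).hasMFDerivAt

/-- The chain rule for `L_d(q₀, q₁) = L̂_d(ρ(q₀, 𝒜_d(q₀, q₁)), π(q₁))`. -/
theorem dL_eq_dLhat (hS : IsSymmetryGroup G S) (q₀ q₁ : Q) (v₀ : TangentSpace 𝓘(ℝ, E) q₀)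
    (v₁ : TangentSpace 𝓘(ℝ, E) q₁) :
    dL S q₀ q₁ (v₀, v₁) = dLhat A hS (rho h (q₀, A.form (q₀, q₁)), proj G Q q₁)
      (pairT (𝓘(ℝ, EB).prod 𝓘(ℝ, EG)) 𝓘(ℝ, EB) (tangentRhoForm A q₀ q₁ v₀ v₁)
        (tangentProj h q₁ v₁)) := by
  have h1 := (hasMFDerivAt_fst (I := 𝓘(ℝ, E)) (I' := 𝓘(ℝ, E)) (q₀, q₁)).prodMk
    (A.hasMFDerivAt_form q₀ q₁)
  have hρ := ((contMDiff_rho h (q₀, A.form (q₀, q₁))).mdifferentiableAt (by simp)).hasMFDerivAt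
  have h2 := (hρ.comp (q₀, q₁) h1).prodMk (hasMFDerivAt_proj_snd h q₀ q₁)
  have h3 := hasMFDerivAt_comp_of_eq
    (hasMFDerivAt_Lhat A hS (rho h (q₀, A.form (q₀, q₁)), proj G Q q₁)) h2 rfl
  have h4 : A.Lhat S hS ∘ (fun p : Q × Q =>
      ((rho h ∘ fun p : Q × Q => (p.1, A.form p)) p, proj G Q p.2)) = S.L := by
    funext p
    exact A.Lcheck_form p.1 p.2
  rw [h4] at h3
  refine (DFunLike.congr_fun (hasMFDerivAt_unique (hasMFDerivAt_L S q₀ q₁) h3) (v₀, v₁)).trans ?_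
  refine congrArg (dLhat A hS (rho h (q₀, A.form (q₀, q₁)), proj G Q q₁)) ?_
  rw [pairT_eq, tangentRhoForm, pairT_eq, pairT_eq]
  rfl

end Differentials

/-! ### The four characterizations of trajectories -/

section Trajectories

variable {E EG EB G Q : Type*}
  [NormedAddCommGroup E] [NormedSpace ℝ E] [NormedAddCommGroup EG] [NormedSpace ℝ EG]
  [NormedAddCommGroup EB] [NormedSpace ℝ EB]
  [TopologicalSpace G] [ChartedSpace EG G] [Group G]
  [TopologicalSpace Q] [ChartedSpace E Q] [IsManifold 𝓘(ℝ, E) ∞ Q] [MulAction G Q]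
  [ChartedSpace EB (Shape G Q)] {h : IsPrincipalBundle E EG EB G Q} {S : NonholonomicDMS E Q}

theorem dAction_eq_sum (S : NonholonomicDMS E Q) {N : ℕ} (q : Fin (N + 1) → Q)
    (δq : ∀ k, TangentSpace 𝓘(ℝ, E) (q k)) :
    S.dAction q δq
      = ∑ k : Fin N, dL S (q k.castSucc) (q k.succ) (δq k.castSucc, δq k.succ) := by
  let f : Fin N → (Fin (N + 1) → E) →L[ℝ] ℝ := fun k => (dL S (q k.castSucc) (q k.succ)).comp
    ((ContinuousLinearMap.proj k.castSucc).prod (ContinuousLinearMap.proj k.succ))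
  have hk : ∀ k : Fin N, HasMFDerivAt (ModelWithCorners.pi fun _ : Fin (N + 1) => 𝓘(ℝ, E)) 𝓘(ℝ, ℝ)
      (fun c : Fin (N + 1) → Q => S.L (c k.castSucc, c k.succ)) q (f k) := fun k =>
    hasMFDerivAt_comp_of_eq (hasMFDerivAt_L S (q k.castSucc) (q k.succ))
      ((hasMFDerivAt_pi_apply q k.castSucc).prodMk (hasMFDerivAt_pi_apply q k.succ)) rfl
  have hsum := HasMFDerivAt.sum (t := Finset.univ) (fun k _ => hk k)
  have heq : (∑ k : Fin N, fun c : Fin (N + 1) → Q => S.L (c k.castSucc, c k.succ))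
      = S.action N := by
    funext c
    rw [Finset.sum_apply]
    rfl
  rw [heq] at hsum
  rw [NonholonomicDMS.dAction, hsum.mfderiv]
  exact sum_apply Finset.univ f (δq : Fin (N + 1) → E)

theorem dAction_eq_sum_D₁L_add_D₂L (S : NonholonomicDMS E Q) {M : ℕ} (q : Fin (M + 1 + 1) → Q)
    (δq : ∀ k, TangentSpace 𝓘(ℝ, E) (q k)) (h0 : δq 0 = 0) (hN : δq (Fin.last (M + 1)) = 0) :
    S.dAction q δq = ∑ a : Fin M,
      (S.D₁L (q a.castSucc.succ) (q a.succ.succ)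
        + S.D₂L (q a.castSucc.castSucc) (q a.castSucc.succ)) (δq a.castSucc.succ) := by
  rw [dAction_eq_sum]
  simp only [dL_apply, add_apply]
  -- split off the first term of the `D₁L` sum and the last term of the `D₂L` sum, which vanish
  rw [Finset.sum_add_distrib, Finset.sum_add_distrib, Fin.sum_univ_succ,
    Fin.sum_univ_castSucc (fun k : Fin (M + 1) => S.D₂L (q k.castSucc) (q k.succ) (δq k.succ))]
  have e0 : S.D₁L (q (0 : Fin (M + 1)).castSucc) (q (0 : Fin (M + 1)).succ)
      (δq (0 : Fin (M + 1)).castSucc) = 0 :=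
    (congrArg (S.D₁L (q 0) (q (0 : Fin (M + 1)).succ)) h0).trans (map_zero _)
  have eN : S.D₂L (q (Fin.last M).castSucc) (q (Fin.last M).succ) (δq (Fin.last M).succ) = 0 :=
    (congrArg (S.D₂L (q (Fin.last M).castSucc) (q (Fin.last (M + 1)))) hN).trans (map_zero _)
  rw [e0, eN, zero_add, add_zero]
  rfl

/-- Pairs of consecutive indices of `Fin (M + 1)` are `a.castSucc, a.succ` with `a : Fin M`; in this
form the point common to both is given by definitionally equal indices. -/
theorem forall_consecutive_iff {M : ℕ} {P : Fin (M + 1) → Fin (M + 1) → Prop} :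
    (∀ i j : Fin (M + 1), (j : ℕ) = i + 1 → P i j) ↔ ∀ a : Fin M, P a.castSucc a.succ := by
  constructor
  · intro hP a
    exact hP _ _ (by simp)
  · intro hP i j hij
    have hi : (i : ℕ) < M := by have := j.isLt; omega
    have h1 : i = (⟨i, hi⟩ : Fin M).castSucc := rfl
    have h2 : j = (⟨i, hi⟩ : Fin M).succ := Fin.ext (by simpa using hij)
    rw [h1, h2]
    exact hP _

/-- The discrete Lagrange–d'Alembert principle is equivalent to the discrete
Lagrange–d'Alembert equations. -/
theorem principle_iff_equations (S : NonholonomicDMS E Q) {N : ℕ} (q : Fin (N + 1) → Q) :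
    (∀ δq : ∀ k, TangentSpace 𝓘(ℝ, E) (q k),
      δq 0 = 0 → δq (Fin.last N) = 0 → (∀ k, δq k ∈ S.D (q k)) → S.dAction q δq = 0) ↔
    ∀ i j : Fin N, (j : ℕ) = i + 1 → ∀ v ∈ S.D (q i.succ),
      (S.D₁L (q i.succ) (q j.succ) + S.D₂L (q i.castSucc) (q i.succ)) v = 0 := by
  cases N with
  | zero =>
    refine ⟨fun _ i => i.elim0, fun _ δq _ _ _ => ?_⟩
    rw [dAction_eq_sum, Finset.univ_eq_empty, Finset.sum_empty]
  | succ M =>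
    rw [forall_consecutive_iff]
    constructor
    · intro hq a v hv
      let δq : ∀ k, TangentSpace 𝓘(ℝ, E) (q k) := Pi.single a.castSucc.succ v
      have hne : ∀ k, k ≠ a.castSucc.succ → δq k = 0 := fun k hk =>
        Pi.single_eq_of_ne (M := fun k => TangentSpace 𝓘(ℝ, E) (q k)) hk v
      have h0 : δq 0 = 0 := hne _ (Fin.succ_ne_zero _).symm
      have hN : δq (Fin.last (M + 1)) = 0 :=
        hne _ (by rw [Fin.succ_castSucc]; exact (Fin.castSucc_lt_last _).ne')
      have := hq δq h0 hN (fun k => by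
        by_cases hk : k = a.castSucc.succ
        · subst hk
          simpa [δq] using hv
        · rw [hne k hk]
          exact zero_mem _)
      rw [dAction_eq_sum_D₁L_add_D₂L S q δq h0 hN, Finset.sum_eq_single a] at this
      · simpa [δq] using this
      · intro b _ hb
        rw [hne b.castSucc.succ (by simpa using hb), map_zero]
      · simp
    · intro hq δq h0 hN hD
      rw [dAction_eq_sum_D₁L_add_D₂L S q δq h0 hN]
      exact Finset.sum_eq_zero fun a _ => hq a _ (hD _)

/-- The reduced kinematic constraint is equivalent to the original one, because `Φ` is injective
and `𝒟_d` is invariant. -/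
theorem reduced_mem_reducedDd_iff (A : AffineDiscreteConnection h) (hS : IsSymmetryGroup G S)
    (q₀ q₁ : Q) :
    ((rho h (q₀, A.form (q₀, q₁)), proj G Q q₁) : ConjBundle h × Shape G Q) ∈ A.reducedDd S
      ↔ (q₀, q₁) ∈ S.Dd := by
  constructor
  · rintro ⟨_, ⟨⟨p₀, p₁⟩, hp, rfl⟩, heq⟩
    have heq' : ((rho h (p₀, A.form (p₀, p₁)), proj G Q p₁) : ConjBundle h × Shape G Q)
      = (rho h (q₀, A.form (q₀, q₁)), proj G Q q₁) := heq
    obtain ⟨hρ, hπ⟩ := Prod.mk.injEq .. ▸ heq'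
    obtain ⟨g, hg⟩ := (rho_eq_iff h).1 hρ.symm
    have hg0 : g • p₀ = q₀ := congrArg Prod.fst hg
    have hg1 : g * A.form (p₀, p₁) * g⁻¹ = A.form (q₀, q₁) := congrArg Prod.snd hg
    rw [← A.form_smul, hg0] at hg1
    have h1 := A.form_smul_lift q₀ (g • p₁)
    rw [hg1, proj_smul, hπ, A.form_smul_lift] at h1
    have := hS.Dd_smul g _ _ hp
    rwa [hg0, ← h1] at this
  · intro hq
    exact ⟨_, ⟨_, hq, rfl⟩, rfl⟩

variable [LieGroup 𝓘(ℝ, EG) ∞ G]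

theorem dReducedAction_eq_sum [IsManifold 𝓘(ℝ, EB) ∞ (Shape G Q)]
    (A : AffineDiscreteConnection h) (hS : IsSymmetryGroup G S) {N : ℕ}
    (c : Fin N → ConjBundle h × Shape G Q)
    (δv : ∀ k, TangentSpace (𝓘(ℝ, EB).prod 𝓘(ℝ, EG)) (c k).1)
    (δτ : ∀ k, TangentSpace 𝓘(ℝ, EB) (c k).2) :
    dReducedAction A hS c δv δτ = ∑ k : Fin N,
      dLhat A hS (c k) (pairT (𝓘(ℝ, EB).prod 𝓘(ℝ, EG)) 𝓘(ℝ, EB) (δv k) (δτ k)) := by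
  let f : Fin N → (Fin N → (EB × EG) × EB) →L[ℝ] ℝ := fun k =>
    (dLhat A hS (c k)).comp (ContinuousLinearMap.proj k)
  have hk : ∀ k : Fin N, HasMFDerivAt
      (ModelWithCorners.pi fun _ : Fin N => (𝓘(ℝ, EB).prod 𝓘(ℝ, EG)).prod 𝓘(ℝ, EB)) 𝓘(ℝ, ℝ)
      (fun c : Fin N → ConjBundle h × Shape G Q => A.Lhat S hS (c k)) c (f k) := fun k =>
    hasMFDerivAt_comp_of_eq (hasMFDerivAt_Lhat A hS (c k)) (hasMFDerivAt_pi_apply c k) rfl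
  have hsum := HasMFDerivAt.sum (t := Finset.univ) (fun k _ => hk k)
  have heq : (∑ k : Fin N, fun c : Fin N → ConjBundle h × Shape G Q => A.Lhat S hS (c k))
      = reducedAction A hS N := by
    funext c
    rw [Finset.sum_apply]
    rfl
  rw [heq] at hsum
  rw [dReducedAction, hsum.mfderiv]
  exact sum_apply Finset.univ f (fun k =>
    pairT (𝓘(ℝ, EB).prod 𝓘(ℝ, EG)) 𝓘(ℝ, EB) (δv k) (δτ k) : Fin N → (EB × EG) × EB)

/-- A variation `δq` of the curve and the variation of the reduced curve which it induces change
the two discrete actions equally. -/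
theorem dReducedAction_eq_dAction [IsManifold 𝓘(ℝ, EB) ∞ (Shape G Q)]
    (A : AffineDiscreteConnection h) (hS : IsSymmetryGroup G S) {N : ℕ} (q : Fin (N + 1) → Q)
    (δq : ∀ k, TangentSpace 𝓘(ℝ, E) (q k)) :
    dReducedAction A hS (reducedCurve A q)
      (fun k => tangentRhoForm A (q k.castSucc) (q k.succ) (δq k.castSucc) (δq k.succ))
      (fun k => tangentProj h (q k.succ) (δq k.succ)) = S.dAction q δq := by
  refine (dReducedAction_eq_sum A hS _ _ _).trans ?_
  rw [dAction_eq_sum]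
  exact Finset.sum_congr rfl fun k _ => (dL_eq_dLhat A hS _ _ _ _).symm

theorem tangentRhoForm_add (A : AffineDiscreteConnection h) (q₀ q₁ : Q)
    (u₀ v₀ : TangentSpace 𝓘(ℝ, E) q₀) (u₁ v₁ : TangentSpace 𝓘(ℝ, E) q₁) :
    tangentRhoForm A q₀ q₁ (u₀ + v₀) (u₁ + v₁)
      = tangentRhoForm A q₀ q₁ u₀ u₁ + tangentRhoForm A q₀ q₁ v₀ v₁ := by
  rw [tangentRhoForm, pairT_add, map_add, pairT_add, map_add]
  rfl

/-- The discrete Lagrange–d'Alembert principle is equivalent to the reduced principle: the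
admissible variations `δq_k` are exactly the vectors `h^{q_k}(δτ_k) + (ξ_k)_Q(q_k)`. -/
theorem principle_iff_reduced_principle [FiniteDimensional ℝ E] [FiniteDimensional ℝ EB]
    [IsManifold 𝓘(ℝ, EB) ∞ (Shape G Q)] (A : AffineDiscreteConnection h)
    (hS : IsSymmetryGroup G S) (C : NonholonomicConnection h S) {N : ℕ} (q : Fin (N + 1) → Q) :
    (∀ δq : ∀ k, TangentSpace 𝓘(ℝ, E) (q k),
      δq 0 = 0 → δq (Fin.last N) = 0 → (∀ k, δq k ∈ S.D (q k)) → S.dAction q δq = 0) ↔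
    ∀ (δτ : ∀ k, TangentSpace 𝓘(ℝ, EB) (proj G Q (q k)))
      (ξ : Fin (N + 1) → GroupLieAlgebra 𝓘(ℝ, EG) G)
      (δv : ∀ k : Fin N, TangentSpace (𝓘(ℝ, EB).prod 𝓘(ℝ, EG)) (reducedCurve A q k).1),
      (∀ k, δτ k ∈ reducedD h S (q k)) → (∀ k, ξ k ∈ gD h S (q k)) →
      δτ 0 = 0 → δτ (Fin.last N) = 0 → ξ 0 = 0 → ξ (Fin.last N) = 0 →
      (∀ k : Fin N, δv k =
        tangentRhoForm A (q k.castSucc) (q k.succ)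
            (C.horLift (q k.castSucc) (δτ k.castSucc)) (C.horLift (q k.succ) (δτ k.succ))
          + tangentRhoForm A (q k.castSucc) (q k.succ)
            (infGen h (q k.castSucc) (ξ k.castSucc)) (infGen h (q k.succ) (ξ k.succ))) →
        dReducedAction A hS (reducedCurve A q) δv (fun k => δτ k.succ) = 0 := by
  have key : ∀ (δτ : ∀ k, TangentSpace 𝓘(ℝ, EB) (proj G Q (q k)))
      (ξ : Fin (N + 1) → GroupLieAlgebra 𝓘(ℝ, EG) G)
      (δv : ∀ k : Fin N, TangentSpace (𝓘(ℝ, EB).prod 𝓘(ℝ, EG)) (reducedCurve A q k).1),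
      (∀ k : Fin N, δv k =
        tangentRhoForm A (q k.castSucc) (q k.succ)
            (C.horLift (q k.castSucc) (δτ k.castSucc)) (C.horLift (q k.succ) (δτ k.succ))
          + tangentRhoForm A (q k.castSucc) (q k.succ)
            (infGen h (q k.castSucc) (ξ k.castSucc)) (infGen h (q k.succ) (ξ k.succ))) →
      dReducedAction A hS (reducedCurve A q) δv (fun k => δτ k.succ)
        = S.dAction q (fun k => C.horLift (q k) (δτ k) + infGen h (q k) (ξ k)) := by
    intro δτ ξ δv hδv
    rw [← dReducedAction_eq_dAction A hS]
    congr 1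
    · funext k
      rw [hδv k]
      exact (tangentRhoForm_add A _ _ _ _ _ _).symm
    · funext k
      rw [map_add, tangentProj_infGen, add_zero, C.tangentProj_horLift]
  constructor
  · intro hq δτ ξ δv hδτ hξ hτ0 hτN hξ0 hξN hδv
    rw [key δτ ξ δv hδv]
    refine hq _ ?_ ?_ fun k => Submodule.add_mem _ (C.horLift_mem (hδτ k)) (hξ k)
    · rw [hτ0, hξ0, map_zero, map_zero, add_zero]
    · rw [hτN, hξN, map_zero, map_zero, add_zero]
  · intro hq δq h0 hN hD
    -- choosing `ξ k = 0` wherever `δq k = 0` gives the boundary conditions on `ξ`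
    have hex : ∀ k, ∃ ξ ∈ gD h S (q k),
        C.horLift (q k) (tangentProj h (q k) (δq k)) + infGen h (q k) ξ = δq k
          ∧ (δq k = 0 → ξ = 0) := by
      intro k
      by_cases hk : δq k = 0
      · refine ⟨0, zero_mem _, ?_, fun _ => rfl⟩
        rw [hk, map_zero, map_zero, map_zero, add_zero]
      · obtain ⟨ξ, hξ, hξ'⟩ := C.exists_gD_of_mem (hD k)
        exact ⟨ξ, hξ, hξ', fun hk' => absurd hk' hk⟩
    choose ξ hξ hsum hzero using hex
    have hred := hq (fun k => tangentProj h (q k) (δq k)) ξ _ (fun k => ⟨_, hD k, rfl⟩) hξ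
      (by rw [h0, map_zero]) (by rw [hN, map_zero]) (hzero _ h0) (hzero _ hN) (fun k => rfl)
    have hkey := (key (fun k => tangentProj h (q k) (δq k)) ξ _ (fun k => rfl)).symm.trans hred
    simpa only [hsum] using hkey

end Trajectories

end DiscreteReduction

theorem mainTheorem7
    {E EG EB G Q : Type*}
    [NormedAddCommGroup E] [NormedSpace ℝ E] [FiniteDimensional ℝ E]
    [NormedAddCommGroup EG] [NormedSpace ℝ EG] [FiniteDimensional ℝ EG]
    [NormedAddCommGroup EB] [NormedSpace ℝ EB] [FiniteDimensional ℝ EB]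
    [TopologicalSpace G] [ChartedSpace EG G] [Group G] [LieGroup 𝓘(ℝ, EG) ∞ G]
    [TopologicalSpace Q] [ChartedSpace E Q] [IsManifold 𝓘(ℝ, E) ∞ Q] [MulAction G Q]
    [ChartedSpace EB (Shape G Q)] [IsManifold 𝓘(ℝ, EB) ∞ (Shape G Q)]
    (h : IsPrincipalBundle E EG EB G Q)
    (S : NonholonomicDMS E Q) (hS : IsSymmetryGroup G S)
    (A : AffineDiscreteConnection h) (C : NonholonomicConnection h S)
    (N : ℕ) (q : Fin (N + 1) → Q) :
    List.TFAE [
      -- the discrete Lagrange-d'Alembert principle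
      (∀ k : Fin N, (q k.castSucc, q k.succ) ∈ S.Dd) ∧
        ∀ δq : ∀ k, TangentSpace 𝓘(ℝ, E) (q k),
          δq 0 = 0 → δq (Fin.last N) = 0 → (∀ k, δq k ∈ S.D (q k)) →
            S.dAction q δq = 0,
      -- the discrete Lagrange-d'Alembert equations at the interior points `q i.succ = q j.castSucc`
      (∀ k : Fin N, (q k.castSucc, q k.succ) ∈ S.Dd) ∧
        ∀ i j : Fin N, (j : ℕ) = i + 1 →
          ∀ v ∈ S.D (q i.succ),
            (S.D₁L (q i.succ) (q j.succ) + S.D₂L (q i.castSucc) (q i.succ)) v = 0,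
      -- the reduced variational principle
      (∀ k : Fin N, reducedCurve A q k ∈ A.reducedDd S) ∧
        ∀ (δτ : ∀ k, TangentSpace 𝓘(ℝ, EB) (proj G Q (q k)))
          (ξ : Fin (N + 1) → GroupLieAlgebra 𝓘(ℝ, EG) G)
          (δv : ∀ k : Fin N,
            TangentSpace (𝓘(ℝ, EB).prod 𝓘(ℝ, EG)) (reducedCurve A q k).1),
          (∀ k, δτ k ∈ reducedD h S (q k)) →
          (∀ k, ξ k ∈ gD h S (q k)) →
          δτ 0 = 0 → δτ (Fin.last N) = 0 → ξ 0 = 0 → ξ (Fin.last N) = 0 →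
          (∀ k : Fin N, δv k =
            tangentRhoForm A (q k.castSucc) (q k.succ)
                (C.horLift (q k.castSucc) (δτ k.castSucc)) (C.horLift (q k.succ) (δτ k.succ))
              + tangentRhoForm A (q k.castSucc) (q k.succ)
                (infGen h (q k.castSucc) (ξ k.castSucc)) (infGen h (q k.succ) (ξ k.succ))) →
            dReducedAction A hS (reducedCurve A q) δv (fun k => δτ k.succ) = 0,
      -- the reduced equations, at the interior points `q i.succ = q j.castSucc`
      (∀ k : Fin N, reducedCurve A q k ∈ A.reducedDd S) ∧
        ∀ i j : Fin N, (j : ℕ) = i + 1 →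
          (∀ w ∈ reducedD h S (q i.succ), phi A C (q i.castSucc) (q i.succ) (q j.succ) w = 0) ∧
          (∀ ξ ∈ gD h S (q i.succ), psi S A (q i.castSucc) (q i.succ) (q j.succ) ξ = 0)
    ] := by
  have hDd : (∀ k : Fin N, reducedCurve A q k ∈ A.reducedDd S) ↔
      ∀ k : Fin N, (q k.castSucc, q k.succ) ∈ S.Dd :=
    forall_congr' fun k => reduced_mem_reducedDd_iff A hS _ _
  tfae_have 1 ↔ 2 := and_congr_right' (principle_iff_equations S q)
  tfae_have 1 ↔ 3 := and_congr hDd.symm (principle_iff_reduced_principle A hS C q)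
  tfae_have 2 ↔ 4 := by
    refine and_congr hDd.symm (forall_congr' fun i => forall_congr' fun j =>
      forall_congr' fun hij => ?_)
    constructor
    · intro hq
      refine ⟨fun w hw => ?_, fun ξ hξ => ?_⟩
      · exact (phi_eq A C _ _ _ w).trans (hq _ (C.horLift_mem hw))
      · exact (psi_eq A hS _ _ _ ξ).trans (hq _ hξ)
    · rintro ⟨hφ, hψ⟩ v hv
      obtain ⟨ξ, hξ, hsum⟩ := C.exists_gD_of_mem hv
      have hφv := hφ (tangentProj h (q i.succ) v) ⟨v, hv, rfl⟩
      rw [← hsum, map_add, ← phi_eq A, ← psi_eq A hS, hφv, hψ ξ hξ, add_zero]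
  tfae_finish
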